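/- **Setting.** There are $N$ players and finitely many one-shot decision makers (DMs), each belonging to one player and acting in a fixed order; $p(k)$ is the player of DM $k$. The primitive random variables are $\zeta=(\omega_0,(\omega_k)_k)$ on a probability space $(\Omega,\mathcal F,P)$, with values in standard Borel spaces. The action space $U_k$ of DM $k$ is an open convex subset of a Euclidean space (for example, the whole space). For each DM $k$, $\downarrow k$ is the set of DMs that precede $k$ (directly or through intermediate DMs); all of them act before $k$, and precedence is transitive. The information structure is partially nested: in the dynamic game $\mathcal P^D$, DM $k$ observes $$y^D_k=\big[\,y^D_{\downarrow k},\ \hat y^D_k\,\big],\qquad \hat y^D_k=g_k\big(h_k(\zeta),u_{\downarrow k}\big),$$ that is, $\hat y^D_k$ and the $\hat y^D_m$ for all $m\in\downarrow k$, where $g_k,h_k$ are measurable maps between standard Borel spaces. In the static game $\mathcal P^S$, DM $k$ observes $y^S_k=[\,y^S_{\downarrow k},\ \hat y^S_k:=h_k(\zeta)\,]$ instead. In both games policies $\gamma=(\gamma_k)_k$ consist of arbitrary measurable maps $\gamma_k$ from the values of the observation $y_k$ to $U_k$, $u_k=\gamma_k(y_k)$, and player $i$ has the cost $J^i=E[c^i(\omega_0,u)]$,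 with $c^i$ Borel measurable. A policy $\gamma^*$ is a *DM-NE* if for every DM $k$, of player $i=p(k)$, $J^i(\gamma^*)$ is finite and $J^i(\gamma^*)\le J^i(\gamma^*_{-k},\beta_k)$ for every policy $\beta_k$ of DM $k$ for which the right-hand side is well defined. It is *stationary* if for every DM $k$, of player $i=p(k)$, $P$-a.s. $$\nabla_{u}\,E\big[c^{i}\big(\omega_0,\gamma^*_{-k}(y_{-k}),u\big)\,\big|\,y_k\big]\Big|_{u=\gamma^*_k(y_k)}=0,$$ where the conditional expectation is taken with respect to the regular conditional distribution of $\zeta$ given $y_k$ and is finite for $u$ near $\gamma_k^*(y_k)$; in $\mathcal P^D$, the observations $y_{-k}$ of the DMs that $k$ precedes are those that result when DM $k$ applies $u$. **Theorem.** Suppose that: 1. (invertibility) for every $k$ and all fixed preceding actions $u_{\downarrow k}$, the map $h_k(\zeta)\mapsto g_k(h_k(\zeta),u_{\downarrow k})$ is invertible (injective) on the realizations of $h_k(\zeta)$; 2. for every $i$ and $\omega_0$, $c^i(\omega_0,\cdot)$ is continuously differentiable and jointly convex in all actions; 3. (proportional costs) whenever some DM of player $i$ precedes some DM of player $j$, there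 is a constant $\alpha^{ij}\in\mathbb R$ with $c^i=\alpha^{ij}c^j$. Let $\gamma^D$ be a policy for $\mathcal P^D$ such that 4. (Condition (C)) for every $k$, $P$-a.s., the action of DM $k$ at preceding actions $u_{\downarrow k}$, namely $\gamma^D_k\big(\{g_m(h_m(\zeta),u_{\downarrow m})\}_{m\in\downarrow k},\,g_k(h_k(\zeta),u_{\downarrow k})\big)$, is an affine function of $u_{\downarrow k}$; 5. (finite expected costs) for every DM $k$ there is $r>0$ such that for every policy $\beta_k$ of DM $k$ in $\mathcal P^D$ with $\|\beta_k-\gamma^D_k\|\le r$ everywhere, if $u^*$ and $u'$ denote the actions in $\mathcal P^D$ under $\gamma^D$ and under $(\gamma^D_{-k},\beta_k)$, then $E|c^{p(k)}(\omega_0,u')|<\infty$ and, for each DM $j$, $E|c^{p(k)}(\omega_0,u^*_{-j},u'_j)|<\infty$. Let $\gamma^S$ be a policy-dependent static reduction of $\gamma^D$, i.e. a policy for $\mathcal P^S$ that leads to the same actions: for every $k$, $\gamma^S_k(y^S_k)=\gamma^D_k(y^D_k)$ $P$-a.s., with $y^D_k$ the observations under $\gamma^D$. Then * $\gamma^D$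 is stationary for $\mathcal P^D$ if and only if $\gamma^S$ is stationary for $\mathcal P^S$; * $\gamma^D$ is a DM-NE for $\mathcal P^D$ if and only if $\gamma^S$ is a DM-NE for $\mathcal P^S$. -/

import Mathlib

open MeasureTheory ProbabilityTheory Topology

/-- The Euclidean space that contains the actions of decision maker (DM) `k`. -/
abbrev Act {M : ℕ} (n : Fin M → ℕ) (k : Fin M) : Type := EuclideanSpace ℝ (Fin (n k))

/-- A stochastic dynamic game with a partially nested information structure.

There are `N` players and `M` one-shot DMs, numbered in the order in which they act; DM `k` belongs
to player `player k`, so that `TE^i = {k | player k = i}`.  A realization of the primitive random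
variables is `z = (ω₀, (ω_k)_k) : Ω₀ × Π k, W k`.  `down k` is the set `↓k` of the DMs that precede
DM `k`: the new observation of DM `k` is `g k (h k z) u_{↓k}`, so it is affected by the actions of
DMs in `↓k` only.  Precedence is understood to include precedence through intermediate DMs. -/
structure NestedGame (N M : ℕ) (Ω₀ : Type*) (W H Y : Fin M → Type*) (n : Fin M → ℕ)
    [MeasurableSpace Ω₀] [∀ k, MeasurableSpace (W k)] [∀ k, MeasurableSpace (H k)]
    [∀ k, MeasurableSpace (Y k)] where
  /-- the player to which a DM belongs -/
  player : Fin M → Fin N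
  /-- the set `↓k` of the DMs that precede DM `k` -/
  down : Fin M → Finset (Fin M)
  down_lt : ∀ {l k}, l ∈ down k → l < k
  down_trans : ∀ {m l k}, m ∈ down l → l ∈ down k → m ∈ down k
  /-- the action space of DM `k` -/
  U : ∀ k, Set (Act n k)
  isOpen_U : ∀ k, IsOpen (U k)
  convex_U : ∀ k, Convex ℝ (U k)
  /-- the part of the observation of DM `k` that does not involve actions -/
  h : ∀ k, Ω₀ × (∀ j, W j) → H k
  measurable_h : ∀ k, Measurable (h k)
  /-- the map that produces the new observation of DM `k` -/
  g : ∀ k, H k → (∀ l : down k, Act n l) → Y k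
  measurable_g : ∀ k, Measurable (Function.uncurry (g k))
  /-- the cost function of a player -/
  c : Fin N → Ω₀ → (∀ k, Act n k) → ℝ
  measurable_c : ∀ i, Measurable (Function.uncurry (c i))

namespace NestedGame

variable {N M : ℕ} {Ω₀ : Type*} {W H Y : Fin M → Type*} {n : Fin M → ℕ}
  [MeasurableSpace Ω₀] [∀ k, MeasurableSpace (W k)] [∀ k, MeasurableSpace (H k)]
  [∀ k, MeasurableSpace (Y k)]

/-- DM `k` together with its precedents: the DMs whose new observations DM `k` knows. -/
abbrev Nest (G : NestedGame N M Ω₀ W H Y n) (k : Fin M) : Type :=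
  {m : Fin M // m = k ∨ m ∈ G.down k}

/-- The values of the information `y^D_k = [y^D_{↓k}, ŷ^D_k]` of DM `k` in the dynamic game. -/
abbrev DynInfo (G : NestedGame N M Ω₀ W H Y n) (k : Fin M) : Type _ := ∀ m : G.Nest k, Y m

/-- The values of the information `y^S_k = [y^S_{↓k}, ŷ^S_k]` of DM `k` in the static game. -/
abbrev StatInfo (G : NestedGame N M Ω₀ W H Y n) (k : Fin M) : Type _ := ∀ m : G.Nest k, H m

/-- The set of all action profiles. -/
def actionSet (G : NestedGame N M Ω₀ W H Y n) : Set (∀ k, Act n k) := Set.univ.pi G.U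

/-- Policies of DM `k` with information in `I`: measurable maps into the action space. -/
def AdmissibleFor (G : NestedGame N M Ω₀ W H Y n) (k : Fin M) {I : Type*} [MeasurableSpace I]
    (β : I → Act n k) : Prop :=
  Measurable β ∧ ∀ y, β y ∈ G.U k

/-- The information of DM `k` in the dynamic game if the actions `u` are applied (only the
components `u_l` with `l ∈ ↓k` matter). -/
def openInfo (G : NestedGame N M Ω₀ W H Y n) (z : Ω₀ × (∀ j, W j)) (u : ∀ k, Act n k)
    (k : Fin M) : G.DynInfo k :=
  fun m => G.g m (G.h m z) (fun l => u l)

/-- The actions that are applied in the dynamic game under the policy profile `γ`. -/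
noncomputable def dynPlay (G : NestedGame N M Ω₀ W H Y n) (γ : ∀ k, G.DynInfo k → Act n k)
    (z : Ω₀ × (∀ j, W j)) (k : Fin M) : Act n k :=
  γ k (fun m => G.g m (G.h m z) (fun l => dynPlay G γ z l))
termination_by k
decreasing_by
  rcases m.2 with hm | hm
  · exact lt_of_lt_of_eq (G.down_lt l.2) (congrArg Fin.val hm)
  · exact (G.down_lt l.2).trans (G.down_lt hm)

/-- The information of DM `k` in the dynamic game under the policy profile `γ`. -/
noncomputable def dynObs (G : NestedGame N M Ω₀ W H Y n) (γ : ∀ k, G.DynInfo k → Act n k)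
    (z : Ω₀ × (∀ j, W j)) (k : Fin M) : G.DynInfo k :=
  G.openInfo z (G.dynPlay γ z) k

theorem dynPlay_eq (G : NestedGame N M Ω₀ W H Y n) (γ : ∀ k, G.DynInfo k → Act n k)
    (z : Ω₀ × (∀ j, W j)) (k : Fin M) : G.dynPlay γ z k = γ k (G.dynObs γ z k) := by
  rw [dynPlay]
  rfl

/-- The information of DM `k` in the static game; it does not depend on the policies. -/
def statObs (G : NestedGame N M Ω₀ W H Y n) (_γ : ∀ k, G.StatInfo k → Act n k)
    (z : Ω₀ × (∀ j, W j)) (k : Fin M) : G.StatInfo k :=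
  fun m => G.h m z

/-- The actions that are applied in the static game under the policy profile `γ`. -/
def statPlay (G : NestedGame N M Ω₀ W H Y n) (γ : ∀ k, G.StatInfo k → Act n k)
    (z : Ω₀ × (∀ j, W j)) (k : Fin M) : Act n k :=
  γ k (G.statObs γ z k)

section Equilibria

variable {Ω : Type*} [MeasurableSpace Ω] {I : Fin M → Type*} [∀ k, MeasurableSpace (I k)]

/-- `γ` is a DM-wise Nash equilibrium of the game in which a policy profile `γ'` leads to the
actions `play γ' z`: for every DM `k` of every player `i`, the expected cost of player `i` under `γ`
is finite, and no deviation `β` of DM `k` alone makes it smaller.  Deviations with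
`E[c⁺] = ∞` have an infinite or undefined expected cost and are not profitable; for every other one
the expected cost exists in `[-∞, ∞)`, and it is required to be at least that of `γ` (so not `-∞`).
-/
def IsDMNash (G : NestedGame N M Ω₀ W H Y n) (μ : Measure Ω) (ζ : Ω → Ω₀ × (∀ j, W j))
    (play : (∀ k, I k → Act n k) → Ω₀ × (∀ j, W j) → ∀ k, Act n k)
    (γ : ∀ k, I k → Act n k) : Prop :=
  ∀ k, Integrable (fun x => G.c (G.player k) (ζ x).1 (play γ (ζ x))) μ ∧
    ∀ β : I k → Act n k, G.AdmissibleFor k β →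
      ∫⁻ x, ENNReal.ofReal
        (G.c (G.player k) (ζ x).1 (play (Function.update γ k β) (ζ x))) ∂μ ≠ ⊤ →
      Integrable (fun x => G.c (G.player k) (ζ x).1 (play (Function.update γ k β) (ζ x))) μ ∧
      ∫ x, G.c (G.player k) (ζ x).1 (play γ (ζ x)) ∂μ ≤
        ∫ x, G.c (G.player k) (ζ x).1 (play (Function.update γ k β) (ζ x)) ∂μ

/-- `γ` is a (DM-wise) stationary policy: for every DM `k` of every player `i`, almost surely,
`∇_u E[c^i(ω₀, γ_{-k}(y_{-k}), u) | y_k] = 0` at `u = γ_k(y_k)`.  The conditional expectation is the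
integral against the regular conditional distribution of `ζ` given `y_k`; it has to be finite for
`u` near `γ_k(y_k)`. -/
def IsStationary (G : NestedGame N M Ω₀ W H Y n) (μ : Measure Ω) [IsFiniteMeasure μ]
    [StandardBorelSpace Ω₀] [Nonempty Ω₀] [∀ k, StandardBorelSpace (W k)] [∀ k, Nonempty (W k)]
    (ζ : Ω → Ω₀ × (∀ j, W j))
    (play : (∀ k, I k → Act n k) → Ω₀ × (∀ j, W j) → ∀ k, Act n k)
    (obs : (∀ k, I k → Act n k) → Ω₀ × (∀ j, W j) → ∀ k, I k)
    (γ : ∀ k, I k → Act n k) : Prop :=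
  ∀ k, ∀ᵐ x ∂μ,
    (∀ᶠ u in 𝓝 (γ k (obs γ (ζ x) k)),
      Integrable (fun z => G.c (G.player k) z.1 (play (Function.update γ k (fun _ => u)) z))
        (condDistrib ζ (fun x' => obs γ (ζ x') k) μ (obs γ (ζ x) k))) ∧
    HasGradientAt
      (fun u => ∫ z, G.c (G.player k) z.1 (play (Function.update γ k (fun _ => u)) z)
        ∂(condDistrib ζ (fun x' => obs γ (ζ x') k) μ (obs γ (ζ x) k)))
      0 (γ k (obs γ (ζ x) k))

end Equilibria

/-- For all fixed preceding actions, `h_k(z)` can be recovered from the new observation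
`g_k(h_k(z), u_{↓k})`, for all realizations `z`. -/
def InvertibleObs (G : NestedGame N M Ω₀ W H Y n) : Prop :=
  ∀ k, ∀ u : ∀ l : G.down k, Act n l, (∀ l : G.down k, u l ∈ G.U l) →
    ∀ z z', G.g k (G.h k z) u = G.g k (G.h k z') u → G.h k z = G.h k z'

/-- The costs are continuously differentiable and jointly convex in the actions. -/
def SmoothConvexCosts (G : NestedGame N M Ω₀ W H Y n) : Prop :=
  ∀ i ω₀, ContDiffOn ℝ 1 (G.c i ω₀) G.actionSet ∧ ConvexOn ℝ G.actionSet (G.c i ω₀)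

/-- If some DM of player `i` precedes some DM of player `j`, then `c^i = α^{ij} c^j`. -/
def ProportionalCosts (G : NestedGame N M Ω₀ W H Y n) : Prop :=
  ∀ i j, (∃ k l, G.player k = i ∧ G.player l = j ∧ k ∈ G.down l) →
    ∃ α : ℝ, ∀ ω₀, ∀ u ∈ G.actionSet, G.c i ω₀ u = α * G.c j ω₀ u

/-- Condition (C): for every DM `k` and almost every realization of `ζ`, the action of DM `k` is an
affine function of the actions `u_{↓k}` that precede it. -/
def ConditionC (G : NestedGame N M Ω₀ W H Y n) {Ω : Type*} [MeasurableSpace Ω] (μ : Measure Ω)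
    (ζ : Ω → Ω₀ × (∀ j, W j)) (γ : ∀ k, G.DynInfo k → Act n k) : Prop :=
  ∀ k, ∀ᵐ x ∂μ, ∃ f : (∀ l : G.down k, Act n l) →ᵃ[ℝ] Act n k,
    ∀ u ∈ G.actionSet, γ k (G.openInfo (ζ x) u k) = f (fun l => u l)

/-- Expected costs are finite near `γ`: after a small deviation `β` of a single DM `k`, the expected
cost of its player is finite, both if the resulting actions of the dynamic game are applied by all
DMs, and if only one DM `j` applies them and the others keep their actions under `γ`. -/
def FiniteCostsNear (G : NestedGame N M Ω₀ W H Y n) {Ω : Type*} [MeasurableSpace Ω] (μ : Measure Ω)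
    (ζ : Ω → Ω₀ × (∀ j, W j)) (γ : ∀ k, G.DynInfo k → Act n k) : Prop :=
  ∀ k, ∃ r > 0, ∀ β : G.DynInfo k → Act n k, G.AdmissibleFor k β → (∀ y, ‖β y - γ k y‖ ≤ r) →
    Integrable (fun x => G.c (G.player k) (ζ x).1
      (G.dynPlay (Function.update γ k β) (ζ x))) μ ∧
    ∀ j, Integrable (fun x => G.c (G.player k) (ζ x).1
      (Function.update (G.dynPlay γ (ζ x)) j (G.dynPlay (Function.update γ k β) (ζ x) j))) μ

/-- `γS` is a policy-dependent static reduction of `γD`: both lead to the same actions a.s. -/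
def IsStaticReduction (G : NestedGame N M Ω₀ W H Y n) {Ω : Type*} [MeasurableSpace Ω]
    (μ : Measure Ω) (ζ : Ω → Ω₀ × (∀ j, W j)) (γD : ∀ k, G.DynInfo k → Act n k)
    (γS : ∀ k, G.StatInfo k → Act n k) : Prop :=
  ∀ k, ∀ᵐ x ∂μ, γS k (G.statObs γS (ζ x) k) = γD k (G.dynObs γD (ζ x) k)

end NestedGame

/-! With the policies of the others frozen, each DM faces a convex stochastic program. In the static
game only one action moves. In the dynamic game, Condition (C), composed along the order of play,
makes all resulting actions affine in the action of DM `k` (`exists_affineMap_dynPlay`), so the cost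
is again convex and differentiable in that action. For such a problem (`ConvexDecision`),
stationarity and optimality are both equivalent to one first-order condition: the expected
derivative of the cost vanishes in every measurable direction `b(y)` for which it is integrable
(`stationary_iff_firstOrder`, `optimal_iff_firstOrder`).

It remains to compare the first-order conditions of the two games. By the chain rule, the derivative
of the dynamic cost of DM `k` in the direction `b` is the derivative of its player's cost, at the
common actions, along the vector of all induced changes of action (`AffineResponse.fderiv_dynCost`).
Split this vector by DM. The component of `k` gives the derivative of the static game. DMs that `k`
does not precede do not react. If `k` precedes `j`, the reaction of `j` is a function of what `j`
knows in the static game (`exists_dynShift_eq`), and the cost of `k`'s player is a multiple of that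
of `j`'s player; so this term is a multiple of the static first-order expression of `j` and vanishes
if `j` satisfies its condition (`integral_fderiv_single_eq_zero`).

Hence, once all DMs that `k` precedes satisfy their static conditions, the static and dynamic
conditions of `k` coincide, since invertibility makes the two information structures equivalent.
Static to dynamic is then direct; dynamic to static is a backward induction from the last DM
(`forall_dynFirstOrder_iff`).

Two measurability questions need analytic sets: Condition (C) must pass from `Ω` to the law of `ζ`
although it need not define a Borel set, and functions determined by an observation must be
measurable functions of it. -/

/-! ### Analytic sets: inner approximation and measurable factorization. -/

section Analytic

theorem isCompact_box (b : ℕ → ℕ) : IsCompact {x : ℕ → ℕ | ∀ i, x i ≤ b i} := by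
  have : {x : ℕ → ℕ | ∀ i, x i ≤ b i} = Set.Icc ⊥ b := Set.Icc_bot.symm
  rw [this]
  exact isCompact_Icc

/-- An open set that contains the compact box `{x | ∀ i, x i ≤ b i}` of Baire space contains one of
the sets `{x | ∀ i < k, x i ≤ b i}`. -/
theorem exists_truncatedBox_subset (b : ℕ → ℕ) {O : Set (ℕ → ℕ)} (hO : IsOpen O)
    (hb : {x | ∀ i, x i ≤ b i} ⊆ O) : ∃ k, {x : ℕ → ℕ | ∀ i < k, x i ≤ b i} ⊆ O := by
  by_contra! hcon
  have hx : ∀ k, ∃ x : ℕ → ℕ, (∀ i < k, x i ≤ b i) ∧ x ∉ O := fun k => by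
    obtain ⟨x, h1, h2⟩ := Set.not_subset.1 (hcon k)
    exact ⟨x, h1, h2⟩
  choose x hx hxO using hx
  have hK := isCompact_box b
  -- Cutting `x k` down to the box leaves its coordinates below `k` unchanged, so a limit of the cut
  -- points is also a limit of the points themselves.
  obtain ⟨y, hy, φ, hφ, hlim⟩ := hK.tendsto_subseq (x := fun k i => min (x k i) (b i))
    (fun k i => min_le_right _ _)
  have hlim' : Filter.Tendsto (x ∘ φ) Filter.atTop (𝓝 y) := by
    rw [tendsto_pi_nhds] at hlim ⊢
    intro i
    refine (hlim i).congr' ?_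
    filter_upwards [Filter.eventually_gt_atTop i] with k hk
    exact min_eq_left (hx _ i (hk.trans_le (hφ.id_le k)))
  obtain ⟨k, hk⟩ := (hlim'.eventually (hO.mem_nhds (hb hy))).exists
  exact hxO _ hk

/-- An analytic set all of whose compact subsets are null sets is a null set. -/
theorem MeasureTheory.AnalyticSet.measure_eq_zero {Z : Type*} [TopologicalSpace Z] [PolishSpace Z]
    [MeasurableSpace Z] [BorelSpace Z] {ν : Measure Z} [IsFiniteMeasure ν] {A : Set Z}
    (hA : AnalyticSet A) (h : ∀ K ⊆ A, IsCompact K → ν K = 0) : ν A = 0 := by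
  rw [AnalyticSet] at hA
  rcases hA with rfl | ⟨φ, hφ, rfl⟩
  · simp
  by_contra hne
  obtain ⟨ε, hε, hεA⟩ := exists_between (pos_iff_ne_zero.2 hne)
  -- By continuity from below, one more coordinate can be bounded while the (outer) measure of the
  -- image stays above `ε`.
  have hstep : ∀ S : Set (ℕ → ℕ), ε < ν (φ '' S) → ∀ k, ∃ m, ε < ν (φ '' (S ∩ {x | x k ≤ m})) := by
    intro S hS k
    have hU : φ '' S = ⋃ m, φ '' (S ∩ {x | x k ≤ m}) := by
      rw [← Set.image_iUnion, ← Set.inter_iUnion]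
      congr 1
      ext x
      simpa using fun _ => ⟨x k, le_rfl⟩
    have hmono : Monotone fun m : ℕ => φ '' (S ∩ {x | x k ≤ m}) := fun m m' hm =>
      Set.image_mono (Set.inter_subset_inter_right _ fun x (hx : x k ≤ m) => hx.trans hm)
    rw [hU, hmono.measure_iUnion] at hS
    exact lt_iSup_iff.1 hS
  choose! m hm using hstep
  let S : ℕ → Set (ℕ → ℕ) := fun k => Nat.rec Set.univ (fun k T => T ∩ {x | x k ≤ m T k}) k
  have hS : ∀ k, ε < ν (φ '' S k) := by
    intro k
    induction k with
    | zero => simpa [S] using hεA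
    | succ k ih => exact hm _ ih k
  let b : ℕ → ℕ := fun k => m (S k) k
  have hSb : ∀ k, S k = {x | ∀ i < k, x i ≤ b i} := by
    intro k
    induction k with
    | zero => ext; simp [S]
    | succ k ih =>
      have : S (k + 1) = S k ∩ {x | x k ≤ b k} := rfl
      rw [this, ih]
      ext x
      simp only [Set.mem_inter_iff, Set.mem_ofPred_eq]
      refine ⟨fun hx i hi => ?_, fun hx => ⟨fun i hi => hx i (hi.trans (Nat.lt_succ_self k)),
        hx k (Nat.lt_succ_self k)⟩⟩
      rcases Nat.lt_succ_iff_lt_or_eq.1 hi with hi | rfl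
      · exact hx.1 i hi
      · exact hx.2
  have hK := isCompact_box b
  have h0 := h _ (Set.image_subset_range φ _) (hK.image hφ)
  let _ := TopologicalSpace.upgradeIsCompletelyMetrizable Z
  -- The image of the full box is compact, hence null, and lies in an open set of measure below `ε`.
  -- Finitely many of the bounds already force the image into that set, against the choice of the
  -- bounds.
  obtain ⟨V, hKV, hV, hVε⟩ := Set.exists_isOpen_lt_of_lt _ ε (h0.trans_lt hε)
  obtain ⟨k, hk⟩ := exists_truncatedBox_subset b (hV.preimage hφ) (Set.image_subset_iff.1 hKV)
  have := (hS k).trans_le (measure_mono (Set.image_subset_iff.2 ((hSb k).subset.trans hk)))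
  exact lt_irrefl _ (this.trans hVε)

/-- A property "for all `v`" of `ζ` that holds almost surely holds almost everywhere for the law of
`ζ`, although the set in question need not be Borel. -/
theorem MeasureTheory.ae_map_forall_of_measurableSet {Ω Z V : Type*} [MeasurableSpace Ω]
    [MeasurableSpace Z] [StandardBorelSpace Z] [MeasurableSpace V] [StandardBorelSpace V]
    {μ : Measure Ω} [IsFiniteMeasure μ] {ζ : Ω → Z} (hζ : Measurable ζ) {R : Set (Z × V)}
    (hR : MeasurableSet R) (h : ∀ᵐ x ∂μ, ∀ v, (ζ x, v) ∈ R) :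
    ∀ᵐ z ∂(μ.map ζ), ∀ v, (z, v) ∈ R := by
  let _ := upgradeStandardBorel Z
  have hA : AnalyticSet (Prod.fst '' Rᶜ) := hR.compl.analyticSet_image measurable_fst
  -- A compact set is Borel, so its pushforward measure is that of its preimage, which lies in the
  -- exceptional null set.
  have h0 := hA.measure_eq_zero (ν := μ.map ζ) fun K hK hKc => by
    rw [Measure.map_apply hζ hKc.measurableSet]
    refine measure_mono_null (fun x hx => ?_) h
    obtain ⟨⟨z, v⟩, hv, hz⟩ := hK hx
    intro hall
    exact hv (by simpa only [← hz] using hall v)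
  refine measure_mono_null (fun z hz => ?_) h0
  obtain ⟨v, hv⟩ := not_forall.1 hz
  exact ⟨(z, v), hv, rfl⟩

/-- Blackwell's theorem: a measurable function that factors through a measurable function
`f` does so measurably. -/
theorem Measurable.exists_measurable_comp_of_factorsThrough {Z A X : Type*} [MeasurableSpace Z]
    [StandardBorelSpace Z] [MeasurableSpace A] [StandardBorelSpace A] [MeasurableSpace X]
    [StandardBorelSpace X] [Nonempty X] {f : Z → A} {q : Z → X} (hf : Measurable f)
    (hq : Measurable q) (h : q.FactorsThrough f) :
    ∃ b : A → X, Measurable b ∧ ∀ z, b (f z) = q z := by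
  let _ := upgradeStandardBorel A
  have hcomap : Measurable[MeasurableSpace.comap f inferInstance] q := by
    intro B hB
    -- The two images are analytic, and disjoint because `q` factors through `f`. A Borel set that
    -- separates them pulls back to `q ⁻¹' B`.
    have h1 : AnalyticSet (f '' (q ⁻¹' B)) := (hq hB).analyticSet_image hf
    have h2 : AnalyticSet (f '' (q ⁻¹' Bᶜ)) := (hq hB.compl).analyticSet_image hf
    have hd : Disjoint (f '' (q ⁻¹' B)) (f '' (q ⁻¹' Bᶜ)) := by
      rw [Set.disjoint_left]
      rintro _ ⟨z, hz, rfl⟩ ⟨z', hz', he⟩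
      exact hz' (by simpa only [Set.mem_preimage, h he] using hz)
    obtain ⟨C, hC1, hC2, hC⟩ := h1.measurablySeparable h2 hd
    refine ⟨C, hC, ?_⟩
    ext z
    refine ⟨fun hz => ?_, fun hz => hC1 ⟨z, hz, rfl⟩⟩
    by_contra hzB
    exact Set.disjoint_left.1 hC2 ⟨z, hzB, rfl⟩ hz
  obtain ⟨b, hb, hqb⟩ := hcomap.exists_eq_measurable_comp
  exact ⟨b, hb, fun z => (congrFun hqb z).symm⟩

end Analytic

/-! ### Directional derivatives of random convex functions. -/

section ConvexCalculus

variable {V : Type*} [NormedAddCommGroup V] [NormedSpace ℝ V] {s : Set V} {f : V → ℝ} {p d : V}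

theorem tendsto_natCast_add_one_atTop : Filter.Tendsto (fun m : ℕ => ‖(m : ℝ) + 1‖) Filter.atTop
    Filter.atTop :=
  tendsto_norm_atTop_atTop.comp
    (Filter.tendsto_atTop_add_const_right _ 1 tendsto_natCast_atTop_atTop)

/-- Steps `1/(m+1)` make the derivative a limit of a sequence, as measurability of limits and
dominated convergence require. -/
theorem HasFDerivAt.tendsto_slope_nat {L : V →L[ℝ] ℝ} (h : HasFDerivAt f L p) (d : V) :
    Filter.Tendsto (fun m : ℕ => ((m : ℝ) + 1) * (f (p + ((m : ℝ) + 1)⁻¹ • d) - f p))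
      Filter.atTop (𝓝 (L d)) := by
  simpa only [smul_eq_mul] using h.lim d tendsto_natCast_add_one_atTop

theorem ConvexOn.slope_nat_le (hf : ConvexOn ℝ s f) (hp : p ∈ s) (hpd : p + d ∈ s) (m : ℕ) :
    ((m : ℝ) + 1) * (f (p + ((m : ℝ) + 1)⁻¹ • d) - f p) ≤ f (p + d) - f p := by
  have hm : (0 : ℝ) < m + 1 := by positivity
  set t : ℝ := ((m : ℝ) + 1)⁻¹ with ht
  have ht0 : 0 < t := by positivity
  have ht1 : t ≤ 1 := inv_le_one_of_one_le₀ (by linarith [(Nat.cast_nonneg m : (0 : ℝ) ≤ m)])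
  have hmt : ((m : ℝ) + 1) * t = 1 := mul_inv_cancel₀ hm.ne'
  have h := hf.2 hp hpd (sub_nonneg.2 ht1) ht0.le (by ring)
  have he : (1 - t) • p + t • (p + d) = p + t • d := by module
  rw [he, smul_eq_mul, smul_eq_mul] at h
  have h' := mul_le_mul_of_nonneg_left h hm.le
  linear_combination h' + (f (p + d) - f p) * hmt

theorem ConvexOn.fderiv_le (hf : ConvexOn ℝ s f) (hp : p ∈ s) (hpd : p + d ∈ s)
    (hd : DifferentiableAt ℝ f p) : fderiv ℝ f p d ≤ f (p + d) - f p :=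
  le_of_tendsto' (hd.hasFDerivAt.tendsto_slope_nat d) fun m => hf.slope_nat_le hp hpd m

theorem ConvexOn.le_fderiv (hf : ConvexOn ℝ s f) (hp : p ∈ s) (hpd : p - d ∈ s)
    (hd : DifferentiableAt ℝ f p) : f p - f (p - d) ≤ fderiv ℝ f p d := by
  have h := hf.fderiv_le hp (d := -d) (by rwa [← sub_eq_add_neg]) hd
  rw [map_neg, ← sub_eq_add_neg] at h
  linarith

theorem Convex.add_inv_smul_mem (hs : Convex ℝ s) (hp : p ∈ s) (hpd : p + d ∈ s) (m : ℕ) :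
    p + ((m : ℝ) + 1)⁻¹ • d ∈ s :=
  hs.add_smul_mem hp hpd ⟨by positivity,
    inv_le_one_of_one_le₀ (by linarith [(Nat.cast_nonneg m : (0 : ℝ) ≤ m)])⟩

/-- Together with `ConvexOn.slope_nat_le`, this encloses all difference quotients between the
derivative and the full increment, which yields a dominating function. -/
theorem ConvexOn.fderiv_le_slope_nat (hf : ConvexOn ℝ s f) (hp : p ∈ s) (hpd : p + d ∈ s)
    (hd : DifferentiableAt ℝ f p) (m : ℕ) :
    fderiv ℝ f p d ≤ ((m : ℝ) + 1) * (f (p + ((m : ℝ) + 1)⁻¹ • d) - f p) := by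
  have h := hf.fderiv_le hp (hf.1.add_inv_smul_mem hp hpd m) hd
  have hm : (0 : ℝ) < m + 1 := by positivity
  rw [map_smul, smul_eq_mul, inv_mul_eq_div, div_le_iff₀ hm] at h
  linarith

variable {Ω : Type*} [MeasurableSpace Ω] {μ : Measure Ω} [MeasurableSpace V] [BorelSpace V]
  [SecondCountableTopology V] {F : Ω → V → ℝ} {P D : Ω → V}

theorem aestronglyMeasurable_fderiv_apply (hF : Measurable (Function.uncurry F))
    (hP : Measurable P) (hD : Measurable D) (hd : ∀ᵐ x ∂μ, DifferentiableAt ℝ (F x) (P x)) :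
    AEStronglyMeasurable (fun x => fderiv ℝ (F x) (P x) (D x)) μ := by
  refine aestronglyMeasurable_of_tendsto_ae Filter.atTop
    (f := fun (m : ℕ) x => ((m : ℝ) + 1) * (F x (P x + ((m : ℝ) + 1)⁻¹ • D x) - F x (P x)))
    (fun m => ?_) (hd.mono fun x hx => hx.hasFDerivAt.tendsto_slope_nat (D x))
  have h1 : Measurable fun x => F x (P x + ((m : ℝ) + 1)⁻¹ • D x) :=
    hF.comp (measurable_id.prodMk (hP.add (hD.const_smul _)))
  have h2 : Measurable fun x => F x (P x) := hF.comp (measurable_id.prodMk hP)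
  exact ((h1.sub h2).const_mul _).aestronglyMeasurable

theorem integrable_of_abs_le_add {φ a b c : Ω → ℝ} (hφ : AEStronglyMeasurable φ μ)
    (ha : Integrable a μ) (hb : Integrable b μ) (hc : Integrable c μ)
    (h1 : ∀ᵐ x ∂μ, φ x ≤ b x - a x) (h2 : ∀ᵐ x ∂μ, a x - c x ≤ φ x) : Integrable φ μ := by
  refine Integrable.mono' ((hb.sub ha).norm.add (ha.sub hc).norm) hφ ?_
  filter_upwards [h1, h2] with x h1 h2
  simp only [Pi.add_apply, Pi.sub_apply, Real.norm_eq_abs]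
  rw [abs_le]
  constructor
  · linarith [neg_abs_le (a x - c x), abs_nonneg (b x - a x)]
  · linarith [le_abs_self (b x - a x), abs_nonneg (a x - c x)]

/-- The directional derivative of a random convex function is integrable if the values at three
points on a line are. -/
theorem integrable_fderiv_apply {S : Set V} (hF : Measurable (Function.uncurry F))
    (hP : Measurable P) (hD : Measurable D) (hd : ∀ᵐ x ∂μ, DifferentiableAt ℝ (F x) (P x))
    (hc : ∀ᵐ x ∂μ, ConvexOn ℝ S (F x)) (hPS : ∀ᵐ x ∂μ, P x ∈ S) (hadd : ∀ᵐ x ∂μ, P x + D x ∈ S)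
    (hsub : ∀ᵐ x ∂μ, P x - D x ∈ S) (i0 : Integrable (fun x => F x (P x)) μ)
    (iadd : Integrable (fun x => F x (P x + D x)) μ)
    (isub : Integrable (fun x => F x (P x - D x)) μ) :
    Integrable (fun x => fderiv ℝ (F x) (P x) (D x)) μ := by
  -- By convexity the derivative lies between `F(P) - F(P - D)` and `F(P + D) - F(P)`.
  refine integrable_of_abs_le_add (aestronglyMeasurable_fderiv_apply hF hP hD hd) i0 iadd isub ?_ ?_
  · filter_upwards [hd, hc, hPS, hadd] with x h1 h2 h3 h4 using h2.fderiv_le h3 h4 h1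
  · filter_upwards [hd, hc, hPS, hsub] with x h1 h2 h3 h4 using h2.le_fderiv h3 h4 h1

/-- Expectation and directional derivative of a random convex function commute. -/
theorem tendsto_slope_integral {S : Set V} (hF : Measurable (Function.uncurry F))
    (hP : Measurable P) (hD : Measurable D) (hd : ∀ᵐ x ∂μ, DifferentiableAt ℝ (F x) (P x))
    (hc : ∀ᵐ x ∂μ, ConvexOn ℝ S (F x)) (hPS : ∀ᵐ x ∂μ, P x ∈ S) (hadd : ∀ᵐ x ∂μ, P x + D x ∈ S)
    (hsub : ∀ᵐ x ∂μ, P x - D x ∈ S) (i0 : Integrable (fun x => F x (P x)) μ)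
    (iadd : Integrable (fun x => F x (P x + D x)) μ)
    (isub : Integrable (fun x => F x (P x - D x)) μ) :
    Filter.Tendsto
      (fun m : ℕ => ∫ x, ((m : ℝ) + 1) * (F x (P x + ((m : ℝ) + 1)⁻¹ • D x) - F x (P x)) ∂μ)
      Filter.atTop (𝓝 (∫ x, fderiv ℝ (F x) (P x) (D x) ∂μ)) := by
  have hI := integrable_fderiv_apply hF hP hD hd hc hPS hadd hsub i0 iadd isub
  refine tendsto_integral_of_dominated_convergence
    (fun x => ‖fderiv ℝ (F x) (P x) (D x)‖ + ‖F x (P x + D x) - F x (P x)‖) (fun m => ?_)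
    (hI.norm.add (iadd.sub i0).norm) (fun m => ?_)
    (hd.mono fun x hx => hx.hasFDerivAt.tendsto_slope_nat (D x))
  · have h1 : Measurable fun x => F x (P x + ((m : ℝ) + 1)⁻¹ • D x) :=
      hF.comp (measurable_id.prodMk (hP.add (hD.const_smul _)))
    have h2 : Measurable fun x => F x (P x) := hF.comp (measurable_id.prodMk hP)
    exact ((h1.sub h2).const_mul _).aestronglyMeasurable
  · filter_upwards [hd, hc, hPS, hadd] with x h1 h2 h3 h4
    have ha := h2.fderiv_le_slope_nat h3 h4 h1 m
    have hb := h2.slope_nat_le h3 h4 m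
    rw [Real.norm_eq_abs, Real.norm_eq_abs, Real.norm_eq_abs, abs_le]
    constructor
    · linarith [neg_abs_le (fderiv ℝ (F x) (P x) (D x)), abs_nonneg (F x (P x + D x) - F x (P x))]
    · linarith [le_abs_self (F x (P x + D x) - F x (P x)),
        abs_nonneg (fderiv ℝ (F x) (P x) (D x))]

end ConvexCalculus

/-! ### Differentiation under the integral sign for convex integrands. -/

section ParametricIntegral

/-- The values of a convex function on a ball are bounded by its values at the centre and at the
vertices of a simplex that contains the ball. -/
theorem ConvexOn.abs_le_of_simplex {E : Type*} [NormedAddCommGroup E] [NormedSpace ℝ E]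
    {ι : Type*} [Fintype ι] {U : Set E} {f : E → ℝ} (hf : ConvexOn ℝ U f) {v : ι → E}
    {δ ρ : ℝ} (hρ : 0 < ρ) (hδ : Metric.ball 0 δ ⊆ convexHull ℝ (Set.range v)) {u₀ : E}
    (hU : ∀ i, u₀ + ρ • v i ∈ U) {u : E}
    (hu : dist u u₀ < ρ * δ) : |f u| ≤ 2 * |f u₀| + ∑ i, |f (u₀ + ρ • v i)| := by
  have hmem : ∀ w : E, ‖w‖ < ρ * δ → u₀ + w ∈ U ∧ f (u₀ + w) ≤ ∑ i, |f (u₀ + ρ • v i)| := by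
    intro w hw
    have hw' : ρ⁻¹ • w ∈ convexHull ℝ (Set.range v) := by
      apply hδ
      rw [mem_ball_zero_iff, norm_smul, norm_inv, Real.norm_of_nonneg hρ.le, inv_mul_lt_iff₀ hρ]
      exact hw
    have hw'' : u₀ + w ∈ convexHull ℝ (Set.range fun i => u₀ + ρ • v i) := by
      let A : E →ᵃ[ℝ] E := (ρ • LinearMap.id : E →ₗ[ℝ] E).toAffineMap + AffineMap.const ℝ E u₀
      have hA : ∀ x, A x = u₀ + ρ • x := fun x => by simp [A, add_comm]
      have h1 : A (ρ⁻¹ • w) ∈ A '' convexHull ℝ (Set.range v) := Set.mem_image_of_mem _ hw'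
      rw [AffineMap.image_convexHull, ← Set.range_comp, hA, smul_inv_smul₀ hρ.ne'] at h1
      convert h1 using 3
      funext i
      exact (hA _).symm
    have hsub : (Set.range fun i => u₀ + ρ • v i) ⊆ U := Set.range_subset_iff.2 hU
    refine ⟨convexHull_min hsub hf.1 hw'', ?_⟩
    obtain ⟨_, ⟨i, rfl⟩, hi⟩ := hf.exists_ge_of_mem_convexHull hsub hw''
    exact hi.trans ((le_abs_self _).trans
      (Finset.single_le_sum (f := fun i => |f (u₀ + ρ • v i)|) (fun _ _ => abs_nonneg _)
        (Finset.mem_univ i)))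
  have hn : ‖u - u₀‖ < ρ * δ := by rwa [← dist_eq_norm]
  obtain ⟨hu1, h1⟩ := hmem (u - u₀) hn
  obtain ⟨hu2, h2⟩ := hmem (-(u - u₀)) (by rwa [norm_neg])
  rw [add_sub_cancel] at hu1 h1
  -- The lower bound comes from reflecting `u` in the centre: `f u₀` is at most the mean of `f` at
  -- `u` and at its mirror image, where the upper bound applies.
  have hmid := hf.2 hu1 hu2 (by norm_num : (0 : ℝ) ≤ 1 / 2) (by norm_num : (0 : ℝ) ≤ 1 / 2)
    (by norm_num)
  have he : (1 / 2 : ℝ) • u + (1 / 2 : ℝ) • (u₀ + -(u - u₀)) = u₀ := by module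
  rw [he, smul_eq_mul, smul_eq_mul] at hmid
  rw [abs_le]
  constructor
  · linarith [neg_abs_le (f u₀)]
  · linarith [abs_nonneg (f u₀)]

variable {E : Type*} [NormedAddCommGroup E] [InnerProductSpace ℝ E] [FiniteDimensional ℝ E]

theorem aestronglyMeasurable_dual_of_apply {Ω : Type*} [MeasurableSpace Ω] {μ : Measure Ω}
    {L : Ω → E →L[ℝ] ℝ} (h : ∀ v, AEStronglyMeasurable (fun x => L x v) μ) :
    AEStronglyMeasurable L μ := by
  have : L = fun x => ∑ i, L x (stdOrthonormalBasis ℝ E i) •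
      innerSL ℝ (stdOrthonormalBasis ℝ E i) := by
    funext x
    ext v
    conv_lhs => rw [← (stdOrthonormalBasis ℝ E).sum_repr v]
    simp [OrthonormalBasis.repr_apply_apply, mul_comm]
  rw [this]
  exact Finset.aestronglyMeasurable_fun_sum _ fun i _ => (h _).smul_const _

/-- Differentiation under the integral sign for convex integrands: integrability at the centre and
at the vertices of a simplex suffices. -/
theorem hasFDerivAt_integral_of_convexOn {ι : Type*} [Fintype ι] [MeasurableSpace E] [BorelSpace E]
    {Z : Type*} [MeasurableSpace Z] {κ : Measure Z} {f : Z → E → ℝ}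
    (hfm : Measurable (Function.uncurry f)) {U : Set E} (hf : ∀ᵐ z ∂κ, ConvexOn ℝ U (f z))
    {u₀ : E} (hd : ∀ᵐ z ∂κ, DifferentiableAt ℝ (f z) u₀)
    {v : ι → E} {δ ρ : ℝ} (hρ : 0 < ρ) (hδ0 : 0 < δ) (hδ : Metric.ball 0 δ ⊆
      convexHull ℝ (Set.range v)) (hU : Metric.ball u₀ (ρ * δ) ⊆ U) (hv : ∀ i, u₀ + ρ • v i ∈ U)
    (i0 : Integrable (fun z => f z u₀) κ) (iv : ∀ i, Integrable (fun z => f z (u₀ + ρ • v i)) κ) :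
    (∀ᶠ u in 𝓝 u₀, Integrable (fun z => f z u) κ) ∧
      HasFDerivAt (fun u => ∫ z, f z u ∂κ) (∫ z, fderiv ℝ (f z) u₀ ∂κ) u₀ := by
  have hr : 0 < ρ * δ := mul_pos hρ hδ0
  have hu₀ : u₀ ∈ U := hU (Metric.mem_ball_self hr)
  let B : Z → ℝ := fun z => 2 * |f z u₀| + ∑ i, |f z (u₀ + ρ • v i)|
  have hB : Integrable B κ :=
    (i0.abs.const_mul 2).add (integrable_finsetSum _ fun i _ => (iv i).abs)
  have hmeas : ∀ u, AEStronglyMeasurable (fun z => f z u) κ := fun u =>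
    (hfm.comp (measurable_id.prodMk measurable_const)).aestronglyMeasurable
  have hbd : ∀ᵐ z ∂κ, ∀ u, dist u u₀ < ρ * δ → |f z u| ≤ B z :=
    hf.mono fun z hz u hu => hz.abs_le_of_simplex hρ hδ hv hu
  constructor
  · filter_upwards [Metric.ball_mem_nhds u₀ hr] with u hu
    exact hB.mono' (hmeas u) (hbd.mono fun z hz => hz u hu)
  · refine (hasFDerivAt_integral_of_dominated_loc_of_lip (𝕜 := ℝ) (F := fun u z => f z u)
      (bound := fun z => 2 * B z / (ρ * δ / 2))
      (Metric.ball_mem_nhds u₀ (half_pos hr)) (.of_forall hmeas) i0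
      (aestronglyMeasurable_dual_of_apply fun w =>
        aestronglyMeasurable_fderiv_apply hfm measurable_const measurable_const hd)
      ?_ ((hB.const_mul 2).div_const _) (hd.mono fun z hz => hz.hasFDerivAt)).2
    filter_upwards [hf, hbd] with z hz hzB
    have hB0 : 0 ≤ B z := (abs_nonneg _).trans (hzB u₀ (by simpa using hr))
    have h := (hz.subset hU (convex_ball _ _)).lipschitzOnWith_of_abs_le (half_pos hr) hzB
    rw [sub_half] at h
    convert h using 1
    ext
    rw [Real.coe_nnabs, Real.coe_toNNReal _ (by positivity), abs_of_nonneg (by positivity)]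

/-- One fixed simplex, scaled by `ρ y`, serves for all observations `y`: integrability has to be
known at finitely many points only, so the exceptional null sets can be united. -/
theorem exists_simplex_around_zero (E : Type*) [NormedAddCommGroup E] [InnerProductSpace ℝ E]
    [FiniteDimensional ℝ E] : ∃ (v : Fin (Module.finrank ℝ E + 1) → E) (δ : ℝ),
      0 < δ ∧ δ ≤ 1 ∧ (∀ i, ‖v i‖ ≤ 1) ∧ Metric.ball 0 δ ⊆ convexHull ℝ (Set.range v) := by
  obtain ⟨b, hb0, hb⟩ := exists_mem_interior_convexHull_affineBasis
    (Metric.closedBall_mem_nhds (0 : E) one_pos)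
  obtain ⟨δ, hδ, hδb⟩ := Metric.mem_nhds_iff.1 (mem_interior_iff_mem_nhds.1 hb0)
  refine ⟨b, min δ 1, lt_min hδ one_pos, min_le_right _ _, fun i => ?_,
    (Metric.ball_subset_ball (min_le_left _ _)).trans hδb⟩
  simpa using hb (subset_convexHull ℝ _ ⟨i, rfl⟩)

end ParametricIntegral

/-! ### Convex decision problems: local optimality and the first-order condition. -/

/-- The decision problem of one agent who observes `Y (ζ x)` and chooses `γ (Y (ζ x)) ∈ U`, with a
random cost `f (ζ x)` that is convex and differentiable on the open convex set `U`, and with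
integrable costs for all perturbations of `γ` bounded by the positive function `ρ`. -/
structure ConvexDecision {Ω Z I E : Type*} [MeasurableSpace Ω] [MeasurableSpace Z]
    [MeasurableSpace I] [NormedAddCommGroup E] [NormedSpace ℝ E] [MeasurableSpace E]
    (μ : Measure Ω) (ζ : Ω → Z) (Y : Z → I) (f : Z → E → ℝ) (U : Set E) (γ : I → E)
    (ρ : I → ℝ) : Prop where
  measurable_ζ : Measurable ζ
  measurable_Y : Measurable Y
  measurable_f : Measurable (Function.uncurry f)
  measurable_γ : Measurable γ
  measurable_ρ : Measurable ρ
  convexOn : ∀ᵐ z ∂(μ.map ζ), ConvexOn ℝ U (f z)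
  differentiableAt : ∀ᵐ z ∂(μ.map ζ), ∀ u ∈ U, DifferentiableAt ℝ (f z) u
  ρ_pos : ∀ y, 0 < ρ y
  add_mem : ∀ y d, ‖d‖ ≤ ρ y → γ y + d ∈ U
  integrable : ∀ b : I → E, Measurable b → (∀ y, ‖b y‖ ≤ ρ y) →
    Integrable (fun x => f (ζ x) (γ (Y (ζ x)) + b (Y (ζ x)))) μ

namespace ConvexDecision

variable {Ω Z I E : Type*} [MeasurableSpace Ω] [MeasurableSpace Z] [MeasurableSpace I]
  [NormedAddCommGroup E] [InnerProductSpace ℝ E] [MeasurableSpace E]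
  {μ : Measure Ω} {ζ : Ω → Z} {Y : Z → I} {f : Z → E → ℝ} {U : Set E} {γ : I → E}
  {ρ : I → ℝ}

/-- First-order condition for an arbitrary direction: if its expectation exists, then the
expected directional derivative is zero. -/
def FirstOrder (μ : Measure Ω) (ζ : Ω → Z) (Y : Z → I) (f : Z → E → ℝ) (γ : I → E) : Prop :=
  ∀ b : I → E, Measurable b →
    Integrable (fun x => fderiv ℝ (f (ζ x)) (γ (Y (ζ x))) (b (Y (ζ x)))) μ →
    ∫ x, fderiv ℝ (f (ζ x)) (γ (Y (ζ x))) (b (Y (ζ x))) ∂μ = 0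

/-- Optimality among the policies within distance `ρ`. -/
def LocallyOptimal (μ : Measure Ω) (ζ : Ω → Z) (Y : Z → I) (f : Z → E → ℝ) (γ : I → E)
    (ρ : I → ℝ) : Prop :=
  ∀ b : I → E, Measurable b → (∀ y, ‖b y‖ ≤ ρ y) →
    ∫ x, f (ζ x) (γ (Y (ζ x))) ∂μ ≤ ∫ x, f (ζ x) (γ (Y (ζ x)) + b (Y (ζ x))) ∂μ

/-- Optimality among all policies. -/
def Optimal (μ : Measure Ω) (ζ : Ω → Z) (Y : Z → I) (f : Z → E → ℝ) (U : Set E) (γ : I → E) :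
    Prop :=
  Integrable (fun x => f (ζ x) (γ (Y (ζ x)))) μ ∧
    ∀ β : I → E, (Measurable β ∧ ∀ y, β y ∈ U) →
      ∫⁻ x, ENNReal.ofReal (f (ζ x) (β (Y (ζ x)))) ∂μ ≠ ⊤ →
      Integrable (fun x => f (ζ x) (β (Y (ζ x)))) μ ∧
      ∫ x, f (ζ x) (γ (Y (ζ x))) ∂μ ≤ ∫ x, f (ζ x) (β (Y (ζ x))) ∂μ

/-- Almost surely, the gradient of the conditionally expected cost is zero. -/
def Stationary [CompleteSpace E] [StandardBorelSpace Z] [Nonempty Z] (μ : Measure Ω)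
    [IsFiniteMeasure μ] (ζ : Ω → Z)
    (Y : Z → I) (f : Z → E → ℝ) (γ : I → E) : Prop :=
  ∀ᵐ x ∂μ,
    (∀ᶠ u in 𝓝 (γ (Y (ζ x))),
      Integrable (fun z => f z u) (condDistrib ζ (fun x' => Y (ζ x')) μ (Y (ζ x)))) ∧
    HasGradientAt (fun u => ∫ z, f z u ∂(condDistrib ζ (fun x' => Y (ζ x')) μ (Y (ζ x))))
      0 (γ (Y (ζ x)))

theorem zero_le_ρ (h : ConvexDecision μ ζ Y f U γ ρ) (y : I) : 0 ≤ ρ y := (h.ρ_pos y).le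

theorem γ_mem (h : ConvexDecision μ ζ Y f U γ ρ) (y : I) : γ y ∈ U := by
  simpa using h.add_mem y 0 (by simpa using h.zero_le_ρ y)

theorem integrable_γ (h : ConvexDecision μ ζ Y f U γ ρ) :
    Integrable (fun x => f (ζ x) (γ (Y (ζ x)))) μ := by
  simpa using h.integrable (fun _ => 0) measurable_const (fun y => by simpa using h.zero_le_ρ y)

theorem measurable_cost (h : ConvexDecision μ ζ Y f U γ ρ) :
    Measurable (Function.uncurry fun x => f (ζ x)) :=
  h.measurable_f.comp ((h.measurable_ζ.comp measurable_fst).prodMk measurable_snd)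

theorem measurable_obs (h : ConvexDecision μ ζ Y f U γ ρ) : Measurable fun x => Y (ζ x) :=
  h.measurable_Y.comp h.measurable_ζ

theorem ae_convexOn (h : ConvexDecision μ ζ Y f U γ ρ) : ∀ᵐ x ∂μ, ConvexOn ℝ U (f (ζ x)) :=
  ae_of_ae_map h.measurable_ζ.aemeasurable h.convexOn

theorem ae_differentiableAt (h : ConvexDecision μ ζ Y f U γ ρ) :
    ∀ᵐ x ∂μ, DifferentiableAt ℝ (f (ζ x)) (γ (Y (ζ x))) :=
  (ae_of_ae_map h.measurable_ζ.aemeasurable h.differentiableAt).mono fun _ hx => hx _ (h.γ_mem _)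

theorem sub_mem (h : ConvexDecision μ ζ Y f U γ ρ) (y : I) (d : E) (hd : ‖d‖ ≤ ρ y) :
    γ y - d ∈ U := by
  rw [sub_eq_add_neg]
  exact h.add_mem y _ (by rwa [norm_neg])

variable [BorelSpace E]

theorem integrable_sub (h : ConvexDecision μ ζ Y f U γ ρ) {b : I → E} (hb : Measurable b)
    (hbρ : ∀ y, ‖b y‖ ≤ ρ y) :
    Integrable (fun x => f (ζ x) (γ (Y (ζ x)) - b (Y (ζ x)))) μ := by
  simpa only [sub_eq_add_neg] using
    h.integrable (fun y => -b y) hb.neg (fun y => by rw [norm_neg]; exact hbρ y)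

/-- Scaling and truncation extend the first-order condition from small to arbitrary directions. -/
theorem firstOrder_of_bounded (h : ConvexDecision μ ζ Y f U γ ρ)
    (hfo : ∀ b : I → E, Measurable b → (∀ y, ‖b y‖ ≤ ρ y) →
      ∫ x, fderiv ℝ (f (ζ x)) (γ (Y (ζ x))) (b (Y (ζ x))) ∂μ = 0) :
    FirstOrder μ ζ Y f γ := by
  intro b hb hint
  -- On `A m` the scaled direction `b / (m + 1)` is small enough for the hypothesis. These sets
  -- exhaust `I` because `ρ` is positive.
  let A : ℕ → Set I := fun m => {y | ‖b y‖ ≤ ((m : ℝ) + 1) * ρ y}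
  have hA : ∀ m, MeasurableSet (A m) := fun m =>
    measurableSet_le hb.norm (h.measurable_ρ.const_mul _)
  have hzero : ∀ m : ℕ, ∫ x, (A m).indicator (fun _ => (1 : ℝ)) (Y (ζ x)) *
      fderiv ℝ (f (ζ x)) (γ (Y (ζ x))) (b (Y (ζ x))) ∂μ = 0 := by
    intro m
    have hm : (0 : ℝ) < m + 1 := by positivity
    have h0 := hfo ((A m).indicator fun y => ((m : ℝ) + 1)⁻¹ • b y)
      ((hb.const_smul _).indicator (hA m)) fun y => by
        by_cases hy : y ∈ A m
        · rw [Set.indicator_of_mem hy, norm_smul, norm_inv, Real.norm_of_nonneg hm.le,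
            inv_mul_le_iff₀ hm]
          exact hy
        · rw [Set.indicator_of_notMem hy, norm_zero]
          exact h.zero_le_ρ y
    have he : ∀ x, fderiv ℝ (f (ζ x)) (γ (Y (ζ x)))
        ((A m).indicator (fun y => ((m : ℝ) + 1)⁻¹ • b y) (Y (ζ x))) = ((m : ℝ) + 1)⁻¹ *
        ((A m).indicator (fun _ => (1 : ℝ)) (Y (ζ x)) *
          fderiv ℝ (f (ζ x)) (γ (Y (ζ x))) (b (Y (ζ x)))) := by
      intro x
      by_cases hy : Y (ζ x) ∈ A m <;> simp [hy]
    simp_rw [he, integral_const_mul] at h0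
    exact (mul_eq_zero.1 h0).resolve_left (inv_ne_zero hm.ne')
  suffices hlim : Filter.Tendsto (fun m : ℕ => ∫ x, (A m).indicator (fun _ => (1 : ℝ)) (Y (ζ x)) *
      fderiv ℝ (f (ζ x)) (γ (Y (ζ x))) (b (Y (ζ x))) ∂μ) Filter.atTop
      (𝓝 (∫ x, fderiv ℝ (f (ζ x)) (γ (Y (ζ x))) (b (Y (ζ x))) ∂μ)) by
    simp only [hzero] at hlim
    exact tendsto_nhds_unique hlim tendsto_const_nhds
  refine tendsto_integral_of_dominated_convergence
    (fun x => ‖fderiv ℝ (f (ζ x)) (γ (Y (ζ x))) (b (Y (ζ x)))‖) (fun m => ?_) hint.norm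
    (fun m => .of_forall fun x => ?_) (.of_forall fun x => ?_)
  · exact ((measurable_const.indicator (hA m)).comp h.measurable_obs).aestronglyMeasurable.mul
      hint.aestronglyMeasurable
  · rw [norm_mul]
    refine mul_le_of_le_one_left (norm_nonneg _) ?_
    by_cases hy : Y (ζ x) ∈ A m <;> simp [hy]
  · refine tendsto_const_nhds.congr' ?_
    obtain ⟨m₀, hm₀⟩ := exists_nat_ge (‖b (Y (ζ x))‖ / ρ (Y (ζ x)))
    filter_upwards [Filter.eventually_ge_atTop m₀] with m hm
    have hy : Y (ζ x) ∈ A m := by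
      have h1 : ‖b (Y (ζ x))‖ ≤ m₀ * ρ (Y (ζ x)) := (div_le_iff₀ (h.ρ_pos _)).1 hm₀
      refine h1.trans (mul_le_mul_of_nonneg_right ?_ (h.zero_le_ρ _))
      have : (m₀ : ℝ) ≤ m := Nat.cast_le.2 hm
      linarith
    simp [hy]

variable [FiniteDimensional ℝ E]

theorem integrable_fderiv (h : ConvexDecision μ ζ Y f U γ ρ) {b : I → E} (hb : Measurable b)
    (hbρ : ∀ y, ‖b y‖ ≤ ρ y) :
    Integrable (fun x => fderiv ℝ (f (ζ x)) (γ (Y (ζ x))) (b (Y (ζ x)))) μ :=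
  integrable_fderiv_apply h.measurable_cost (h.measurable_γ.comp h.measurable_obs)
    (hb.comp h.measurable_obs) h.ae_differentiableAt h.ae_convexOn (.of_forall fun _ => h.γ_mem _)
    (.of_forall fun _ => h.add_mem _ _ (hbρ _)) (.of_forall fun _ => h.sub_mem _ _ (hbρ _))
    h.integrable_γ (h.integrable b hb hbρ) (h.integrable_sub hb hbρ)

/-- The gradient inequality of convex functions, integrated. -/
theorem locallyOptimal_of_fderiv (h : ConvexDecision μ ζ Y f U γ ρ)
    (hfo : ∀ b : I → E, Measurable b → (∀ y, ‖b y‖ ≤ ρ y) →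
      ∫ x, fderiv ℝ (f (ζ x)) (γ (Y (ζ x))) (b (Y (ζ x))) ∂μ = 0) :
    LocallyOptimal μ ζ Y f γ ρ := by
  intro b hb hbρ
  rw [← sub_nonneg, ← integral_sub (h.integrable b hb hbρ) h.integrable_γ, ← hfo b hb hbρ]
  refine integral_mono_ae (h.integrable_fderiv hb hbρ)
    ((h.integrable b hb hbρ).sub h.integrable_γ) ?_
  filter_upwards [h.ae_convexOn, h.ae_differentiableAt] with x h1 h2
  exact h1.fderiv_le (h.γ_mem _) (h.add_mem _ _ (hbρ _)) h2

/-- The integral is the limit of the difference quotients of the expected cost along `b / (m + 1)`,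
which are nonnegative by local optimality. -/
theorem integral_fderiv_nonneg (h : ConvexDecision μ ζ Y f U γ ρ)
    (hlo : LocallyOptimal μ ζ Y f γ ρ) {b : I → E} (hb : Measurable b) (hbρ : ∀ y, ‖b y‖ ≤ ρ y) :
    0 ≤ ∫ x, fderiv ℝ (f (ζ x)) (γ (Y (ζ x))) (b (Y (ζ x))) ∂μ := by
  refine ge_of_tendsto' (tendsto_slope_integral h.measurable_cost
    (h.measurable_γ.comp h.measurable_obs) (hb.comp h.measurable_obs) h.ae_differentiableAt
    h.ae_convexOn (.of_forall fun _ => h.γ_mem _)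
    (.of_forall fun _ => h.add_mem _ _ (hbρ _)) (.of_forall fun _ => h.sub_mem _ _ (hbρ _))
    h.integrable_γ (h.integrable b hb hbρ) (h.integrable_sub hb hbρ)) fun m => ?_
  have hb' : Measurable fun y => ((m : ℝ) + 1)⁻¹ • b y := hb.const_smul _
  have hbρ' : ∀ y, ‖((m : ℝ) + 1)⁻¹ • b y‖ ≤ ρ y := fun y => by
    rw [norm_smul, norm_inv, Real.norm_of_nonneg (by positivity : (0 : ℝ) ≤ m + 1)]
    exact (mul_le_of_le_one_left (norm_nonneg _) (inv_le_one_of_one_le₀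
      (by linarith [(Nat.cast_nonneg m : (0 : ℝ) ≤ m)]))).trans (hbρ y)
  rw [integral_const_mul, integral_sub (h.integrable _ hb' hbρ') h.integrable_γ]
  exact mul_nonneg (by positivity) (sub_nonneg.2 (hlo _ hb' hbρ'))

theorem integral_fderiv_eq_zero (h : ConvexDecision μ ζ Y f U γ ρ)
    (hlo : LocallyOptimal μ ζ Y f γ ρ) {b : I → E} (hb : Measurable b) (hbρ : ∀ y, ‖b y‖ ≤ ρ y) :
    ∫ x, fderiv ℝ (f (ζ x)) (γ (Y (ζ x))) (b (Y (ζ x))) ∂μ = 0 := by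
  have h1 := h.integral_fderiv_nonneg hlo hb hbρ
  have h2 := h.integral_fderiv_nonneg hlo hb.neg
    (fun y => by rw [Pi.neg_apply, norm_neg]; exact hbρ y)
  simp only [Pi.neg_apply, map_neg, integral_neg] at h2
  linarith

theorem locallyOptimal_iff_firstOrder (h : ConvexDecision μ ζ Y f U γ ρ) :
    LocallyOptimal μ ζ Y f γ ρ ↔ FirstOrder μ ζ Y f γ :=
  ⟨fun hlo => h.firstOrder_of_bounded fun _ hb hbρ => h.integral_fderiv_eq_zero hlo hb hbρ,
    fun hfo => h.locallyOptimal_of_fderiv fun b hb hbρ => hfo b hb (h.integrable_fderiv hb hbρ)⟩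

theorem Optimal.locallyOptimal (h : ConvexDecision μ ζ Y f U γ ρ) (ho : Optimal μ ζ Y f U γ) :
    LocallyOptimal μ ζ Y f γ ρ := fun b hb hbρ =>
  (ho.2 (fun y => γ y + b y) ⟨h.measurable_γ.add hb, fun y => h.add_mem y _ (hbρ y)⟩
    (h.integrable b hb hbρ).lintegral_lt_top.ne).2

section Disintegration

theorem integrable_map_prodMk {Y' : Ω → I} (hζ : Measurable ζ) (hY : Measurable Y')
    {φ : I → Z → ℝ} (hφ : Measurable (Function.uncurry φ))
    (hint : Integrable (fun x => φ (Y' x) (ζ x)) μ) :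
    Integrable (Function.uncurry φ) (μ.map fun x => (Y' x, ζ x)) :=
  (integrable_map_measure hφ.aestronglyMeasurable (hY.prodMk hζ).aemeasurable).2 hint

variable [StandardBorelSpace Z] [Nonempty Z] [IsFiniteMeasure μ]

/-- The joint law of `(Y', ζ)` is the law of `Y'` composed with the conditional distribution, and
its second marginal is the law of `ζ`. -/
theorem ae_ae_condDistrib {Y' : Ω → I} (hζ : Measurable ζ) (hY : Measurable Y') {p : Z → Prop}
    (h : ∀ᵐ z ∂(μ.map ζ), p z) : ∀ᵐ y ∂(μ.map Y'), ∀ᵐ z ∂(condDistrib ζ Y' μ y), p z := by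
  refine Measure.ae_ae_of_ae_compProd (p := fun yz => p yz.2) ?_
  rw [compProd_map_condDistrib hζ.aemeasurable]
  have hm : (μ.map fun x => (Y' x, ζ x)).map Prod.snd = μ.map ζ := by
    rw [Measure.map_map measurable_snd (hY.prodMk hζ)]
    rfl
  rw [← hm] at h
  exact ae_of_ae_map measurable_snd.aemeasurable h

theorem lintegral_condDistrib {Y' : Ω → I} (hζ : Measurable ζ) (hY : Measurable Y')
    {φ : I → Z → ENNReal} (hφ : Measurable (Function.uncurry φ)) :
    ∫⁻ x, ∫⁻ z, φ (Y' x) z ∂(condDistrib ζ Y' μ (Y' x)) ∂μ = ∫⁻ x, φ (Y' x) (ζ x) ∂μ := by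
  have h1 : ∫⁻ x, φ (Y' x) (ζ x) ∂μ =
      ∫⁻ p, Function.uncurry φ p ∂(μ.map fun x => (Y' x, ζ x)) := by
    rw [lintegral_map hφ (hY.prodMk hζ)]
    rfl
  rw [h1, ← compProd_map_condDistrib hζ.aemeasurable, Measure.lintegral_compProd hφ,
    lintegral_map _ hY]
  · rfl
  · exact hφ.lintegral_kernel_prod_right'

theorem setIntegral_condDistrib {Y' : Ω → I} (hζ : Measurable ζ) (hY : Measurable Y')
    {φ : I → Z → ℝ} (hφ : Measurable (Function.uncurry φ))
    (hint : Integrable (fun x => φ (Y' x) (ζ x)) μ) {A : Set I} (hA : MeasurableSet A) :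
    ∫ y in A, ∫ z, φ y z ∂(condDistrib ζ Y' μ y) ∂(μ.map Y') =
      ∫ x, A.indicator (fun _ => (1 : ℝ)) (Y' x) * φ (Y' x) (ζ x) ∂μ := by
  have h1 : ∫ x, A.indicator (fun _ => (1 : ℝ)) (Y' x) * φ (Y' x) (ζ x) ∂μ =
      ∫ x in Y' ⁻¹' A, φ (Y' x) (ζ x) ∂μ := by
    rw [← integral_indicator (hY hA)]
    refine integral_congr_ae (.of_forall fun x => ?_)
    by_cases hx : Y' x ∈ A <;> simp [hx]
  have h2 : ∫ x in Y' ⁻¹' A, φ (Y' x) (ζ x) ∂μ =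
      ∫ p in A ×ˢ Set.univ, Function.uncurry φ p ∂(μ.map fun x => (Y' x, ζ x)) := by
    rw [setIntegral_map (hA.prod .univ) hφ.aestronglyMeasurable (hY.prodMk hζ).aemeasurable]
    congr 2
    ext
    simp
  have hi := integrable_map_prodMk hζ hY hφ hint
  rw [h1, h2]
  rw [← compProd_map_condDistrib hζ.aemeasurable] at hi ⊢
  rw [Measure.setIntegral_compProd hA .univ hi.integrableOn]
  simp

end Disintegration

end ConvexDecision

/-! ### Stationarity, optimality and the first-order condition are equivalent. -/

theorem integrable_of_lintegral_ofReal_ne_top {Ω : Type*} [MeasurableSpace Ω] {μ : Measure Ω}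
    {X : Ω → ℝ} (hX : AEStronglyMeasurable X μ) (h1 : ∫⁻ x, ENNReal.ofReal (X x) ∂μ ≠ ⊤)
    (h2 : ∫⁻ x, ENNReal.ofReal (-X x) ∂μ ≠ ⊤) : Integrable X μ := by
  refine ⟨hX, lt_of_le_of_lt ?_ (ENNReal.add_lt_top.2 ⟨h1.lt_top, h2.lt_top⟩)⟩
  rw [← lintegral_add_left' hX.aemeasurable.ennreal_ofReal]
  refine lintegral_mono fun x => ?_
  rw [Real.enorm_eq_ofReal_abs]
  rcases le_total 0 (X x) with h | h
  · rw [abs_of_nonneg h]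
    exact le_self_add
  · rw [abs_of_nonpos h]
    exact le_add_self

/-- The left side makes sense without integrability and can be integrated over the observation by
Tonelli alone. This handles deviations of which only the positive part of the cost is known to be
integrable. -/
theorem lintegral_ofReal_neg_le_iff {Ω : Type*} [MeasurableSpace Ω] {μ : Measure Ω} {X : Ω → ℝ}
    (hX : Integrable X μ) :
    ∫⁻ x, ENNReal.ofReal (-X x) ∂μ ≤ ∫⁻ x, ENNReal.ofReal (X x) ∂μ ↔ 0 ≤ ∫ x, X x ∂μ := by
  rw [integral_eq_lintegral_pos_part_sub_lintegral_neg_part hX, sub_nonneg]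
  exact (ENNReal.toReal_le_toReal hX.neg.lintegral_lt_top.ne hX.lintegral_lt_top.ne).symm

/-- A stationary point of an expected convex function minimizes it, even where the positive part
alone has a finite expectation. -/
theorem lintegral_neg_le_of_hasGradientAt_zero {Z E : Type*} [MeasurableSpace Z]
    [NormedAddCommGroup E] [InnerProductSpace ℝ E] [CompleteSpace E] [MeasurableSpace E]
    {κ : Measure Z} {f : Z → E → ℝ} {U : Set E}
    (hfm : Measurable (Function.uncurry f)) (hf : ∀ᵐ z ∂κ, ConvexOn ℝ U (f z)) {u₀ u : E}
    (hu₀ : u₀ ∈ U) (hu : u ∈ U) (hint : ∀ᶠ w in 𝓝 u₀, Integrable (fun z => f z w) κ)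
    (hgrad : HasGradientAt (fun w => ∫ z, f z w ∂κ) 0 u₀)
    (hfin : ∫⁻ z, ENNReal.ofReal (f z u - f z u₀) ∂κ ≠ ⊤) :
    ∫⁻ z, ENNReal.ofReal (-(f z u - f z u₀)) ∂κ ≤ ∫⁻ z, ENNReal.ofReal (f z u - f z u₀) ∂κ := by
  have hmeas : ∀ w, Measurable fun z => f z w := fun w =>
    hfm.comp (measurable_id.prodMk measurable_const)
  have hlim : Filter.Tendsto (fun m : ℕ => u₀ + ((m : ℝ) + 1)⁻¹ • (u - u₀)) Filter.atTop
      (𝓝 u₀) := by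
    have h1 : Filter.Tendsto (fun m : ℕ => ((m : ℝ) + 1)⁻¹) Filter.atTop (𝓝 0) := by
      simpa only [one_div] using tendsto_one_div_add_atTop_nhds_zero_nat (𝕜 := ℝ)
    simpa using tendsto_const_nhds.add (h1.smul_const (u - u₀))
  have hslope : ∀ m : ℕ, ∀ᵐ z ∂κ,
      ((m : ℝ) + 1) * (f z (u₀ + ((m : ℝ) + 1)⁻¹ • (u - u₀)) - f z u₀) ≤ f z u - f z u₀ := by
    intro m
    filter_upwards [hf] with z hz
    simpa only [add_sub_cancel] using hz.slope_nat_le hu₀ (d := u - u₀) (by simpa) m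
  have hqint : ∀ᶠ m : ℕ in Filter.atTop, Integrable
      (fun z => ((m : ℝ) + 1) * (f z (u₀ + ((m : ℝ) + 1)⁻¹ • (u - u₀)) - f z u₀)) κ :=
    (hlim.eventually hint).mono fun m hm => (hm.sub hint.self_of_nhds).const_mul _
  -- The increment is bounded below by an integrable difference quotient, so its negative part has a
  -- finite integral.
  have hXint : Integrable (fun z => f z u - f z u₀) κ := by
    obtain ⟨m, hm⟩ := hqint.exists
    refine integrable_of_lintegral_ofReal_ne_top ((hmeas u).sub (hmeas u₀)).aestronglyMeasurable
      hfin (ne_top_of_le_ne_top hm.neg.lintegral_lt_top.ne (lintegral_mono_ae ?_))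
    filter_upwards [hslope m] with z hz
    exact ENNReal.ofReal_le_ofReal (neg_le_neg hz)
  rw [lintegral_ofReal_neg_le_iff hXint]
  -- The difference quotients of the expected cost tend to zero and are at most the expected
  -- increment.
  have hgrad' := (hasGradientAt_iff_hasFDerivAt.1 hgrad).tendsto_slope_nat (u - u₀)
  rw [map_zero, zero_apply] at hgrad'
  refine le_of_tendsto hgrad' ?_
  filter_upwards [hqint, hlim.eventually hint] with m hm hm'
  have h := integral_mono_ae hm hXint (hslope m)
  rwa [integral_const_mul, integral_sub hm' hint.self_of_nhds] at h

namespace ConvexDecision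

variable {Ω Z I E : Type*} [MeasurableSpace Ω] [MeasurableSpace Z] [MeasurableSpace I]
  [NormedAddCommGroup E] [InnerProductSpace ℝ E] [FiniteDimensional ℝ E] [MeasurableSpace E]
  {μ : Measure Ω} {ζ : Ω → Z} {Y : Z → I} {f : Z → E → ℝ} {U : Set E} {γ : I → E} {ρ : I → ℝ}
  [StandardBorelSpace Z] [Nonempty Z] [IsFiniteMeasure μ]

/-- Given almost every observation, the conditionally expected cost is convex with zero gradient at
`γ y`, so no action improves on it. Integrating over the observation compares `γ` with any policy
`β`. -/
theorem Stationary.optimal (h : ConvexDecision μ ζ Y f U γ ρ) (hs : Stationary μ ζ Y f γ) :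
    Optimal μ ζ Y f U γ := by
  refine ⟨h.integrable_γ, fun β hβ hfin => ?_⟩
  have hfm : ∀ {β : I → E}, Measurable β → Measurable fun p : I × Z => f p.2 (β p.1) :=
    fun hβ => h.measurable_f.comp (measurable_snd.prodMk (hβ.comp measurable_fst))
  let X : I → Z → ℝ := fun y z => f z (β y) - f z (γ y)
  have hX : Measurable (Function.uncurry X) := (hfm hβ.1).sub (hfm h.measurable_γ)
  -- The positive part of the difference is at most the positive part of the cost of `β` plus the
  -- negative part of that of `γ`.
  have hXfin : ∫⁻ x, ENNReal.ofReal (X (Y (ζ x)) (ζ x)) ∂μ ≠ ⊤ := by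
    refine ne_top_of_le_ne_top (ENNReal.add_ne_top.2
      ⟨hfin, h.integrable_γ.neg.lintegral_lt_top.ne⟩) ?_
    rw [← lintegral_add_right' _
      h.integrable_γ.neg.aestronglyMeasurable.aemeasurable.ennreal_ofReal]
    refine lintegral_mono fun x => ?_
    simp only [X, sub_eq_add_neg]
    exact ENNReal.ofReal_add_le
  have hpos : Measurable (Function.uncurry fun y z => ENNReal.ofReal (X y z)) := hX.ennreal_ofReal
  have hneg : Measurable (Function.uncurry fun y z => ENNReal.ofReal (-X y z)) :=
    hX.neg.ennreal_ofReal
  have hle : ∫⁻ x, ENNReal.ofReal (-X (Y (ζ x)) (ζ x)) ∂μ ≤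
      ∫⁻ x, ENNReal.ofReal (X (Y (ζ x)) (ζ x)) ∂μ := by
    have e1 := lintegral_condDistrib (μ := μ) h.measurable_ζ h.measurable_obs hpos
    have e2 := lintegral_condDistrib (μ := μ) h.measurable_ζ h.measurable_obs hneg
    rw [← e1, ← e2]
    rw [← e1] at hXfin
    have hm : Measurable fun x => ∫⁻ z, ENNReal.ofReal (X (Y (ζ x)) z)
        ∂(condDistrib ζ (fun x' => Y (ζ x')) μ (Y (ζ x))) :=
      (Measurable.lintegral_kernel_prod_right' hpos).comp h.measurable_obs
    have hc := ae_of_ae_map h.measurable_obs.aemeasurable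
      (ae_ae_condDistrib h.measurable_ζ h.measurable_obs h.convexOn)
    refine lintegral_mono_ae ?_
    filter_upwards [hs, hc, ae_lt_top hm hXfin] with x hx hcx hfx
    exact lintegral_neg_le_of_hasGradientAt_zero h.measurable_f hcx (h.γ_mem _) (hβ.2 _) hx.1 hx.2
      hfx.ne
  have hXm : Measurable fun x => X (Y (ζ x)) (ζ x) :=
    hX.comp (h.measurable_obs.prodMk h.measurable_ζ)
  have hXint := integrable_of_lintegral_ofReal_ne_top hXm.aestronglyMeasurable hXfin
    (ne_top_of_le_ne_top hXfin hle)
  have hβint : Integrable (fun x => f (ζ x) (β (Y (ζ x)))) μ :=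
    (hXint.add h.integrable_γ).congr (.of_forall fun x => sub_add_cancel _ _)
  refine ⟨hβint, ?_⟩
  rw [← sub_nonneg, ← integral_sub hβint h.integrable_γ]
  exact (lintegral_ofReal_neg_le_iff hXint).1 hle

variable [BorelSpace E]

/-- Deviating only when the observation lies in an arbitrary measurable set `A` turns the inequality
of expectations into one of conditional expectations. -/
theorem LocallyOptimal.ae_le (h : ConvexDecision μ ζ Y f U γ ρ)
    (hlo : LocallyOptimal μ ζ Y f γ ρ) {b : I → E} (hb : Measurable b) (hbρ : ∀ y, ‖b y‖ ≤ ρ y) :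
    ∀ᵐ y ∂(μ.map fun x => Y (ζ x)),
      0 ≤ ∫ z, (f z (γ y + b y) - f z (γ y)) ∂(condDistrib ζ (fun x => Y (ζ x)) μ y) := by
  have hfm : ∀ {β : I → E}, Measurable β → Measurable fun p : I × Z => f p.2 (β p.1) :=
    fun hβ => h.measurable_f.comp (measurable_snd.prodMk (hβ.comp measurable_fst))
  let X : I → Z → ℝ := fun y z => f z (γ y + b y) - f z (γ y)
  have hX : Measurable (Function.uncurry X) :=
    (hfm (h.measurable_γ.add hb)).sub (hfm h.measurable_γ)
  have hXint : Integrable (fun x => X (Y (ζ x)) (ζ x)) μ :=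
    (h.integrable b hb hbρ).sub h.integrable_γ
  refine ae_nonneg_of_forall_setIntegral_nonneg ((integrable_map_prodMk h.measurable_ζ
    h.measurable_obs hX hXint).integral_condDistrib_map h.measurable_ζ.aemeasurable)
    fun A hA _ => ?_
  rw [setIntegral_condDistrib h.measurable_ζ h.measurable_obs hX hXint hA]
  have hbA : ∀ y, ‖A.indicator b y‖ ≤ ρ y := fun y =>
    (norm_indicator_le_norm_self b y).trans (hbρ y)
  have hl := sub_nonneg.2 (hlo (A.indicator b) (hb.indicator hA) hbA)
  rw [← integral_sub (h.integrable _ (hb.indicator hA) hbA) h.integrable_γ] at hl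
  refine hl.trans_eq (integral_congr_ae (.of_forall fun x => ?_))
  by_cases hx : Y (ζ x) ∈ A <;> simp [hx, X]

/-- Countably many deviations `± ρ e_i / (m + 1)` suffice, so almost every observation is good for
all of them. The simplex makes the conditionally expected cost differentiable there, and its
derivative is nonnegative along every `± e_i`, hence zero. -/
theorem LocallyOptimal.stationary (h : ConvexDecision μ ζ Y f U γ ρ)
    (hlo : LocallyOptimal μ ζ Y f γ ρ) : Stationary μ ζ Y f γ := by
  have hfm : ∀ {β : I → E}, Measurable β → Measurable fun p : I × Z => f p.2 (β p.1) :=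
    fun hβ => h.measurable_f.comp (measurable_snd.prodMk (hβ.comp measurable_fst))
  obtain ⟨v, δ, hδ0, hδ1, hv, hδ⟩ := exists_simplex_around_zero E
  have hρv : ∀ i y, ‖ρ y • v i‖ ≤ ρ y := fun i y => by
    rw [norm_smul, Real.norm_of_nonneg (h.zero_le_ρ y)]
    exact mul_le_of_le_one_right (h.zero_le_ρ y) (hv i)
  have hint : ∀ {b : I → E}, Measurable b → (∀ y, ‖b y‖ ≤ ρ y) →
      ∀ᵐ y ∂(μ.map fun x => Y (ζ x)), Integrable (fun z => f z (γ y + b y))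
        (condDistrib ζ (fun x => Y (ζ x)) μ y) := fun {b} hb hbρ =>
    (integrable_map_prodMk (φ := fun y z => f z (γ y + b y)) h.measurable_ζ h.measurable_obs
      (hfm (h.measurable_γ.add hb)) (h.integrable b hb hbρ)).condDistrib_ae_map
      h.measurable_ζ.aemeasurable
  let e := stdOrthonormalBasis ℝ E
  let d : ℕ → ℝ → Fin (Module.finrank ℝ E) → I → E := fun m s i y =>
    (((m : ℝ) + 1)⁻¹) • (ρ y • (s • e i))
  have hdm : ∀ m s i, Measurable (d m s i) := fun m s i =>
    (h.measurable_ρ.smul_const _).const_smul _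
  have hdρ : ∀ m s i y, |s| = 1 → ‖d m s i y‖ ≤ ρ y := fun m s i y hs => by
    have h1 : ‖s • e i‖ = 1 := by rw [norm_smul, Real.norm_eq_abs, hs, e.norm_eq_one, one_mul]
    rw [norm_smul, norm_smul, h1, mul_one, Real.norm_of_nonneg (h.zero_le_ρ y),
      Real.norm_of_nonneg (by positivity)]
    exact mul_le_of_le_one_left (h.zero_le_ρ y) (inv_le_one_of_one_le₀
      (by linarith [(Nat.cast_nonneg m : (0 : ℝ) ≤ m)]))
  have hpos : ∀ s : ℝ, |s| = 1 → ∀ᵐ y ∂(μ.map fun x => Y (ζ x)), ∀ m i,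
      0 ≤ ∫ z, (f z (γ y + d m s i y) - f z (γ y)) ∂(condDistrib ζ (fun x => Y (ζ x)) μ y) := by
    intro s hs
    rw [ae_all_iff]
    intro m
    rw [ae_all_iff]
    exact fun i => LocallyOptimal.ae_le h hlo (hdm m s i) fun y => hdρ m s i y hs
  have hvint : ∀ᵐ y ∂(μ.map fun x => Y (ζ x)), ∀ i, Integrable (fun z => f z (γ y + ρ y • v i))
      (condDistrib ζ (fun x => Y (ζ x)) μ y) := by
    rw [ae_all_iff]
    exact fun i => hint (h.measurable_ρ.smul_const _) (hρv i)
  have h0int := hint (b := fun _ => 0) measurable_const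
    (fun y => by rw [norm_zero]; exact h.zero_le_ρ y)
  simp only [add_zero] at h0int
  refine ae_of_ae_map h.measurable_obs.aemeasurable (p := fun y =>
    (∀ᶠ u in 𝓝 (γ y), Integrable (fun z => f z u) (condDistrib ζ (fun x' => Y (ζ x')) μ y)) ∧
    HasGradientAt (fun u => ∫ z, f z u ∂(condDistrib ζ (fun x' => Y (ζ x')) μ y)) 0 (γ y)) ?_
  filter_upwards [h0int, hvint, hpos 1 (by simp), hpos (-1) (by simp),
    ae_ae_condDistrib h.measurable_ζ h.measurable_obs h.convexOn,
    ae_ae_condDistrib h.measurable_ζ h.measurable_obs h.differentiableAt]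
    with y hy0 hyv hp hn hc hd
  have hball : Metric.ball (γ y) (ρ y * δ) ⊆ U := by
    intro u hu
    have := h.add_mem y (u - γ y) (by
      rw [← dist_eq_norm]
      exact (Metric.mem_ball.1 hu).le.trans (mul_le_of_le_one_right (h.zero_le_ρ y) hδ1))
    rwa [add_sub_cancel] at this
  obtain ⟨hev, hder⟩ := hasFDerivAt_integral_of_convexOn h.measurable_f hc
    (hd.mono fun z hz => hz _ (h.γ_mem y)) (h.ρ_pos y) hδ0 hδ hball
    (fun i => h.add_mem y _ (hρv i y)) hy0 hyv
  refine ⟨hev, ?_⟩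
  set L := ∫ z, fderiv ℝ (f z) (γ y) ∂(condDistrib ζ (fun x => Y (ζ x)) μ y) with hL
  have hnonneg : ∀ s : ℝ, (∀ m i, 0 ≤ ∫ z, (f z (γ y + d m s i y) - f z (γ y))
      ∂(condDistrib ζ (fun x => Y (ζ x)) μ y)) → ∀ i, 0 ≤ L (s • e i) := by
    intro s hs i
    have hlim := hder.tendsto_slope_nat (ρ y • (s • e i))
    have h1 : 0 ≤ L (ρ y • (s • e i)) := by
      refine ge_of_tendsto hlim ?_
      have hto : Filter.Tendsto (fun m : ℕ => γ y + d m s i y) Filter.atTop (𝓝 (γ y)) := by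
        have h1 : Filter.Tendsto (fun m : ℕ => ((m : ℝ) + 1)⁻¹) Filter.atTop (𝓝 0) := by
          simpa only [one_div] using tendsto_one_div_add_atTop_nhds_zero_nat (𝕜 := ℝ)
        simpa using tendsto_const_nhds.add (h1.smul_const (ρ y • (s • e i)))
      filter_upwards [hto.eventually hev] with m hm
      rw [← integral_sub hm hy0]
      exact mul_nonneg (by positivity) (hs m i)
    rw [map_smul, smul_eq_mul] at h1
    exact nonneg_of_mul_nonneg_right h1 (h.ρ_pos y)
  have hL0 : L = 0 := by
    have hz : ∀ i, L (e i) = 0 := fun i => by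
      have h1 := hnonneg 1 hp i
      have h2 := hnonneg (-1) hn i
      rw [one_smul] at h1
      rw [neg_one_smul, map_neg] at h2
      linarith
    ext w
    rw [← e.sum_repr w, map_sum]
    simp [hz]
  rw [hasGradientAt_iff_hasFDerivAt, map_zero, ← hL0]
  exact hder

/-- For a convex decision problem, stationarity, optimality and the first-order condition are
equivalent. -/
theorem stationary_iff_firstOrder (h : ConvexDecision μ ζ Y f U γ ρ) :
    Stationary μ ζ Y f γ ↔ FirstOrder μ ζ Y f γ :=
  ⟨fun hs => h.locallyOptimal_iff_firstOrder.1 (Optimal.locallyOptimal h (Stationary.optimal h hs)),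
    fun hfo => LocallyOptimal.stationary h (h.locallyOptimal_iff_firstOrder.2 hfo)⟩

theorem optimal_iff_firstOrder (h : ConvexDecision μ ζ Y f U γ ρ) :
    Optimal μ ζ Y f U γ ↔ FirstOrder μ ζ Y f γ :=
  ⟨fun ho => h.locallyOptimal_iff_firstOrder.1 (Optimal.locallyOptimal h ho), fun hfo =>
    Stationary.optimal h (LocallyOptimal.stationary h (h.locallyOptimal_iff_firstOrder.2 hfo))⟩

end ConvexDecision

/-! ### Play of the dynamic game: information, measurability, affine response. -/

namespace NestedGame

variable {N M : ℕ} {Ω₀ : Type*} {W H Y : Fin M → Type*} {n : Fin M → ℕ}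
  [MeasurableSpace Ω₀] [∀ k, MeasurableSpace (W k)] [∀ k, MeasurableSpace (H k)]
  [∀ k, MeasurableSpace (Y k)] {G : NestedGame N M Ω₀ W H Y n}
  {γ : ∀ k, G.DynInfo k → Act n k} {z z' : Ω₀ × (∀ j, W j)} {u u' : ∀ k, Act n k} {j k : Fin M}

theorem isOpen_actionSet (G : NestedGame N M Ω₀ W H Y n) : IsOpen G.actionSet :=
  isOpen_set_pi Set.finite_univ fun k _ => G.isOpen_U k

theorem mem_down_of_nest (m : G.Nest k) {l : Fin M} (hl : l ∈ G.down m) : l ∈ G.down k := by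
  obtain ⟨m, rfl | hm⟩ := m
  · exact hl
  · exact G.down_trans hl hm

theorem openInfo_congr (h : ∀ l ∈ G.down k, u l = u' l) : G.openInfo z u k = G.openInfo z u' k := by
  funext m
  exact congrArg (G.g m (G.h m z)) (funext fun l => h l (mem_down_of_nest m l.2))

theorem dynPlay_mem (hγ : ∀ k, G.AdmissibleFor k (γ k)) (z : Ω₀ × (∀ j, W j)) :
    G.dynPlay γ z ∈ G.actionSet := fun k _ => by
  rw [dynPlay_eq]
  exact (hγ k).2 _

theorem admissibleFor_update (hγ : ∀ k, G.AdmissibleFor k (γ k)) {β : G.DynInfo k → Act n k}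
    (hβ : G.AdmissibleFor k β) (j : Fin M) : G.AdmissibleFor j (Function.update γ k β j) := by
  rcases eq_or_ne j k with rfl | h
  · rwa [Function.update_self]
  · rw [Function.update_of_ne h]
    exact hγ j

/-- By transitivity of precedence, if `k` does not precede `j`, then it precedes no DM whose action
affects the information of `j`. -/
theorem dynPlay_update_of_notMem (β : G.DynInfo k → Act n k) (z : Ω₀ × (∀ j, W j)) (hjk : j ≠ k)
    (hj : k ∉ G.down j) : G.dynPlay (Function.update γ k β) z j = G.dynPlay γ z j := by
  induction j using WellFoundedLT.induction with
  | ind j ih =>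
    rw [dynPlay_eq, dynPlay_eq, Function.update_of_ne hjk]
    refine congrArg (γ j) (openInfo_congr fun l hl => ih l (G.down_lt hl) ?_ fun hk => ?_)
    · rintro rfl
      exact hj hl
    · exact hj (G.down_trans hk hl)

theorem dynObs_update_self (β : G.DynInfo k → Act n k) (z : Ω₀ × (∀ j, W j)) :
    G.dynObs (Function.update γ k β) z k = G.dynObs γ z k :=
  openInfo_congr fun _ hl => dynPlay_update_of_notMem β z (G.down_lt hl).ne
    fun hk => lt_irrefl _ ((G.down_lt hk).trans (G.down_lt hl))

theorem dynPlay_update_self (β : G.DynInfo k → Act n k) (z : Ω₀ × (∀ j, W j)) :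
    G.dynPlay (Function.update γ k β) z k = β (G.dynObs γ z k) := by
  rw [dynPlay_eq, Function.update_self, dynObs_update_self]

/-- A deviation has the same effect as the constant deviation to the action that it prescribes. -/
theorem dynPlay_update_const (β : G.DynInfo k → Act n k) (z : Ω₀ × (∀ j, W j)) :
    G.dynPlay (Function.update γ k fun _ => β (G.dynObs γ z k)) z =
      G.dynPlay (Function.update γ k β) z := by
  funext j
  induction j using WellFoundedLT.induction with
  | ind j ih =>
    rcases eq_or_ne j k with rfl | hjk
    · rw [dynPlay_update_self, dynPlay_update_self]
    · rw [dynPlay_eq, dynPlay_eq, Function.update_of_ne hjk, Function.update_of_ne hjk]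
      exact congrArg (γ j) (openInfo_congr fun l hl => ih l (G.down_lt hl))

theorem dynPlay_update_const_self (γ : ∀ k, G.DynInfo k → Act n k) (z : Ω₀ × (∀ j, W j))
    (k : Fin M) :
    G.dynPlay (Function.update γ k fun _ => γ k (G.dynObs γ z k)) z = G.dynPlay γ z := by
  rw [dynPlay_update_const, Function.update_eq_self]

theorem measurable_openInfo (G : NestedGame N M Ω₀ W H Y n) (k : Fin M) :
    Measurable fun q : (Ω₀ × (∀ j, W j)) × (∀ l : G.down k, Act n l) =>
      (fun m => G.g m (G.h m q.1) (fun l => q.2 ⟨l, mem_down_of_nest m l.2⟩) : G.DynInfo k) :=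
  measurable_pi_lambda _ fun m => by
    have h : Measurable fun q : (Ω₀ × (∀ j, W j)) × (∀ l : G.down k, Act n l) =>
        (G.h m q.1, fun l : G.down m => q.2 ⟨l, mem_down_of_nest m l.2⟩) :=
      ((G.measurable_h m).comp measurable_fst).prodMk (measurable_pi_lambda _ fun l =>
        (measurable_pi_apply (⟨l, mem_down_of_nest m l.2⟩ : G.down k)).comp measurable_snd)
    exact (G.measurable_g m).comp h

/-- The parameter makes the actions jointly measurable in the realization and in the constant action
of a deviating DM. -/
theorem measurable_dynPlay_param {P : Type*} [MeasurableSpace P]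
    {Γ : P → ∀ j, G.DynInfo j → Act n j}
    (hΓ : ∀ j, Measurable fun q : P × G.DynInfo j => Γ q.1 j q.2) (j : Fin M) :
    Measurable fun q : P × (Ω₀ × (∀ j, W j)) => G.dynPlay (Γ q.1) q.2 j := by
  induction j using WellFoundedLT.induction with
  | ind j ih =>
    simp_rw [dynPlay_eq (k := j)]
    have hu : Measurable fun q : P × (Ω₀ × (∀ j, W j)) =>
        fun l : G.down j => G.dynPlay (Γ q.1) q.2 l :=
      measurable_pi_lambda _ fun l => ih l (G.down_lt l.2)
    exact (hΓ j).comp (measurable_fst.prodMk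
      ((G.measurable_openInfo j).comp (measurable_snd.prodMk hu)))

theorem measurable_dynPlay (hγ : ∀ k, Measurable (γ k)) : Measurable (G.dynPlay γ) :=
  measurable_pi_lambda _ fun j =>
    (measurable_dynPlay_param (Γ := fun _ : Unit => γ) (fun j => (hγ j).comp measurable_snd) j).comp
      ((measurable_const (a := ())).prodMk measurable_id)

theorem measurable_dynObs (hγ : ∀ k, Measurable (γ k)) (k : Fin M) :
    Measurable fun z => G.dynObs γ z k :=
  (G.measurable_openInfo k).comp (measurable_id.prodMk
    (measurable_pi_lambda _ fun _ => (measurable_pi_apply _).comp (measurable_dynPlay hγ)))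

theorem measurable_dynPlay_update_const (hγ : ∀ k, Measurable (γ k)) (k : Fin M) :
    Measurable fun q : (Ω₀ × (∀ j, W j)) × Act n k =>
      G.dynPlay (Function.update γ k fun _ => q.2) q.1 := by
  refine measurable_pi_lambda _ fun j => ?_
  have hΓ : ∀ j, Measurable fun q : Act n k × G.DynInfo j =>
      Function.update γ k (fun _ => q.1) j q.2 := by
    intro j
    rcases eq_or_ne j k with rfl | h
    · simp_rw [Function.update_self]
      exact measurable_fst
    · simp_rw [Function.update_of_ne h]
      exact (hγ j).comp measurable_snd
  exact (measurable_dynPlay_param (Γ := fun a => Function.update γ k fun _ => a) hΓ j).comp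
    (measurable_snd.prodMk measurable_fst)

theorem measurable_statObs (γ' : ∀ k, G.StatInfo k → Act n k) (k : Fin M) :
    Measurable fun z => G.statObs γ' z k :=
  measurable_pi_lambda _ fun m => G.measurable_h m

/-- The actions of DM `j` depend on the primitive random variables only through the information of
DM `j` in the static game. -/
theorem dynPlay_congr (γ : ∀ k, G.DynInfo k → Act n k) (h : ∀ m : G.Nest j, G.h m z = G.h m z') :
    G.dynPlay γ z j = G.dynPlay γ z' j := by
  induction j using WellFoundedLT.induction with
  | ind j ih =>
    rw [dynPlay_eq, dynPlay_eq]
    refine congrArg (γ j) (funext fun m => ?_)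
    change G.g m (G.h m z) _ = G.g m (G.h m z') _
    rw [h m]
    refine congrArg _ (funext fun l => ih l (G.down_lt (mem_down_of_nest m l.2)) fun m' => h
      ⟨m', Or.inr ?_⟩)
    obtain ⟨m', rfl | hm'⟩ := m'
    · exact mem_down_of_nest m l.2
    · exact G.down_trans hm' (mem_down_of_nest m l.2)

theorem dynObs_congr (γ : ∀ k, G.DynInfo k → Act n k) (h : ∀ m : G.Nest j, G.h m z = G.h m z') :
    G.dynObs γ z j = G.dynObs γ z' j := by
  funext m
  change G.g m (G.h m z) _ = G.g m (G.h m z') _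
  rw [h m]
  refine congrArg _ (funext fun l => dynPlay_congr γ fun m' => h ⟨m', Or.inr ?_⟩)
  obtain ⟨m', rfl | hm'⟩ := m'
  · exact mem_down_of_nest m l.2
  · exact G.down_trans hm' (mem_down_of_nest m l.2)

/-- Under invertibility, the information of the static game can be recovered from that of the
dynamic game. -/
theorem h_eq_of_dynObs_eq (hinv : G.InvertibleObs) (hγ : ∀ k, G.AdmissibleFor k (γ k))
    (h : G.dynObs γ z k = G.dynObs γ z' k) (m : G.Nest k) : G.h m z = G.h m z' := by
  obtain ⟨m, hm⟩ := m
  induction m using WellFoundedLT.induction with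
  | ind m ih =>
    have hg : G.g m (G.h m z) (fun l => G.dynPlay γ z l) =
        G.g m (G.h m z') (fun l => G.dynPlay γ z' l) := congrFun h ⟨m, hm⟩
    -- By induction the static observations of all earlier DMs agree, hence so do their actions;
    -- invertibility then applies at these fixed actions.
    have hu : (fun l : G.down m => G.dynPlay γ z l) = fun l : G.down m => G.dynPlay γ z' l := by
      funext l
      have hlk : ∀ i : Fin M, i ∈ G.down m → i ∈ G.down k := fun i hi => mem_down_of_nest ⟨m, hm⟩ hi
      refine dynPlay_congr γ fun m' => ?_
      obtain ⟨m', rfl | hm'⟩ := m'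
      · exact ih l (G.down_lt l.2) (Or.inr (hlk l l.2))
      · exact ih m' ((G.down_lt hm').trans (G.down_lt l.2))
          (Or.inr (hlk m' (G.down_trans hm' l.2)))
    rw [← hu] at hg
    exact hinv m _ (fun l => dynPlay_mem hγ z l trivial) z z' hg

/-- If the actions of all DMs are affine in the preceding actions, then a deviation of one DM
changes all actions in an affine way. -/
theorem exists_affineMap_dynPlay (hγ : ∀ k, G.AdmissibleFor k (γ k)) (z : Ω₀ × (∀ j, W j))
    (hz : ∀ j, ∃ f : (∀ l : G.down j, Act n l) →ᵃ[ℝ] Act n j,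
      ∀ u ∈ G.actionSet, γ j (G.openInfo z u j) = f (fun l => u l)) (k : Fin M) :
    ∃ A : Act n k →ᵃ[ℝ] (∀ j, Act n j), ∀ u ∈ G.U k,
      G.dynPlay (Function.update γ k fun _ => u) z = A u := by
  suffices h : ∀ j, ∃ A : Act n k →ᵃ[ℝ] Act n j, ∀ u ∈ G.U k,
      G.dynPlay (Function.update γ k fun _ => u) z j = A u by
    choose A hA using h
    exact ⟨AffineMap.pi A, fun u hu => funext fun j => hA j u hu⟩
  intro j
  induction j using WellFoundedLT.induction with
  | ind j ih =>
    rcases eq_or_ne j k with rfl | hjk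
    · exact ⟨AffineMap.id ℝ _, fun u _ => dynPlay_update_self _ _⟩
    · choose A hA using fun l : G.down j => ih l (G.down_lt l.2)
      obtain ⟨f, hf⟩ := hz j
      refine ⟨f.comp (AffineMap.pi A), fun u hu => ?_⟩
      have hadm := admissibleFor_update hγ (β := fun _ => u) ⟨measurable_const, fun _ => hu⟩
      rw [dynPlay_eq, Function.update_of_ne hjk]
      change γ j (G.openInfo z _ j) = _
      rw [hf _ (dynPlay_mem hadm z), AffineMap.comp_apply]
      exact congrArg f (funext fun l => hA l u hu)

theorem statPlay_update (γ' : ∀ k, G.StatInfo k → Act n k) (β : G.StatInfo k → Act n k)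
    (z : Ω₀ × (∀ j, W j)) : G.statPlay (Function.update γ' k β) z =
      Function.update (G.statPlay γ' z) k (β (G.statObs γ' z k)) := by
  funext j
  rcases eq_or_ne j k with rfl | h
  · rw [Function.update_self, statPlay, Function.update_self]
    rfl
  · rw [Function.update_of_ne h, statPlay, Function.update_of_ne h]
    rfl

theorem measurable_statPlay {γ' : ∀ k, G.StatInfo k → Act n k} (hγ' : ∀ k, Measurable (γ' k)) :
    Measurable (G.statPlay γ') :=
  measurable_pi_lambda _ fun j => (hγ' j).comp (measurable_statObs γ' j)

section ConditionC

variable [Nonempty Ω₀] [∀ k, Nonempty (W k)]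

theorem actionSet_nonempty (hγ : ∀ k, G.AdmissibleFor k (γ k)) : G.actionSet.Nonempty :=
  ⟨_, dynPlay_mem hγ (Classical.arbitrary _)⟩

variable [StandardBorelSpace Ω₀] [∀ k, StandardBorelSpace (W k)]

/-- Condition (C) holds almost everywhere for the law of the primitive random variables. -/
theorem ConditionC.ae_map {Ω : Type*} [MeasurableSpace Ω] {μ : Measure Ω} [IsFiniteMeasure μ]
    {ζ : Ω → Ω₀ × (∀ j, W j)} (hζ : Measurable ζ) (hγ : ∀ k, G.AdmissibleFor k (γ k))
    (hC : G.ConditionC μ ζ γ) : ∀ᵐ z ∂(μ.map ζ), ∀ k,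
      ∃ f : (∀ l : G.down k, Act n l) →ᵃ[ℝ] Act n k,
        ∀ u ∈ G.actionSet, γ k (G.openInfo z u k) = f (fun l => u l) := by
  rw [ae_all_iff]
  intro k
  let V := ∀ l : G.down k, Act n l
  obtain ⟨u₀, hu₀⟩ := actionSet_nonempty hγ
  have hopen : IsOpen (Set.univ.pi fun l : G.down k => G.U l) :=
    isOpen_set_pi Set.finite_univ fun l _ => G.isOpen_U l
  -- An affine basis inside the open set of preceding actions: the map is affine there exactly if
  -- its value at `v` is the combination of its values at the basis with the barycentric coordinates
  -- of `v`. This replaces the existence of `f` by an identity for all `v`, measurable in `(z, v)`.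
  obtain ⟨b, -, hb⟩ := exists_mem_interior_convexHull_affineBasis
    (hopen.mem_nhds (show (fun l => u₀ l : V) ∈ _ from fun l _ => hu₀ l trivial))
  have hbU : ∀ i, b i ∈ Set.univ.pi fun l : G.down k => G.U l := fun i =>
    hb (subset_convexHull ℝ _ ⟨i, rfl⟩)
  let q : (Ω₀ × (∀ j, W j)) → V → Act n k := fun z v =>
    γ k (fun m => G.g m (G.h m z) (fun l => v ⟨l, mem_down_of_nest m l.2⟩))
  have hq : Measurable (Function.uncurry q) := (hγ k).1.comp (G.measurable_openInfo k)
  have hext : ∀ v ∈ Set.univ.pi fun l : G.down k => G.U l,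
      ∃ u ∈ G.actionSet, (fun l => u l : V) = v := by
    intro v hv
    refine ⟨fun j => if hj : j ∈ G.down k then v ⟨j, hj⟩ else u₀ j, fun j _ => ?_, ?_⟩
    · by_cases hj : j ∈ G.down k
      · simpa [hj] using hv ⟨j, hj⟩ trivial
      · simpa [hj] using hu₀ j trivial
    · funext l
      simp [l.2]
  let R : Set ((Ω₀ × (∀ j, W j)) × V) :=
    {p | p.2 ∈ Set.univ.pi (fun l : G.down k => G.U l) →
      q p.1 p.2 = ∑ i, b.coord i p.2 • q p.1 (b i)}
  have hcoord : ∀ i, Measurable (b.coord i) := fun i =>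
    (AffineMap.continuous_of_finiteDimensional (b.coord i)).measurable
  have hR : MeasurableSet R := by
    have h1 : MeasurableSet {p : (Ω₀ × (∀ j, W j)) × V |
        p.2 ∈ Set.univ.pi (fun l : G.down k => G.U l)} := measurable_snd hopen.measurableSet
    have h2 : MeasurableSet {p : (Ω₀ × (∀ j, W j)) × V |
        q p.1 p.2 = ∑ i, b.coord i p.2 • q p.1 (b i)} :=
      measurableSet_eq_fun hq (Finset.measurable_fun_sum _ fun i _ =>
        ((hcoord i).comp measurable_snd).smul
          (hq.comp (measurable_fst.prodMk measurable_const)))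
    have : R = {p : (Ω₀ × (∀ j, W j)) × V |
        p.2 ∈ Set.univ.pi (fun l : G.down k => G.U l)}ᶜ ∪ {p : (Ω₀ × (∀ j, W j)) × V |
        q p.1 p.2 = ∑ i, b.coord i p.2 • q p.1 (b i)} := by
      ext p
      exact imp_iff_not_or
    rw [this]
    exact h1.compl.union h2
  have hae : ∀ᵐ x ∂μ, ∀ v, (ζ x, v) ∈ R := by
    filter_upwards [hC k] with x ⟨f, hf⟩ v hv
    have hqf : ∀ w ∈ Set.univ.pi (fun l : G.down k => G.U l), q (ζ x) w = f w := by
      intro w hw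
      obtain ⟨u, hu, rfl⟩ := hext w hw
      exact hf u hu
    simp only [hqf v hv, hqf _ (hbU _)]
    have h1 : ∑ i, b.coord i v = 1 := b.sum_coord_apply_eq_one v
    have h2 := congrArg f (b.affineCombination_coord_eq_self v)
    rw [Finset.map_affineCombination _ _ _ h1,
      Finset.affineCombination_eq_linear_combination _ _ _ h1] at h2
    exact h2.symm
  filter_upwards [ae_map_forall_of_measurableSet hζ hR hae] with z hz
  let Lw : (Fin (Module.finrank ℝ V + 1) → ℝ) →ₗ[ℝ] Act n k :=
    ∑ i, (LinearMap.proj i).smulRight (q z (b i))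
  refine ⟨Lw.toAffineMap.comp b.coords, fun u hu => ?_⟩
  have := hz (fun l => u l) fun l _ => hu l trivial
  refine Eq.trans (show γ k (G.openInfo z u k) = q z (fun l => u l) from rfl) (this.trans ?_)
  simp only [AffineMap.comp_apply, LinearMap.coe_toAffineMap, Lw, LinearMap.sum_apply,
    LinearMap.smulRight_apply, LinearMap.proj_apply]
  rfl

end ConditionC

end NestedGame

/-! ### Convexity and the chain rule under a substitution affine on `U`. -/

section AffineSubstitution

variable {E V : Type*} [NormedAddCommGroup E] [NormedSpace ℝ E] [FiniteDimensional ℝ E]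
  [NormedAddCommGroup V] [NormedSpace ℝ V] {c : V → ℝ} {φ : E → V} {A : E →ᵃ[ℝ] V} {U : Set E}

theorem AffineMap.hasFDerivAt_of_finiteDimensional (A : E →ᵃ[ℝ] V) (u : E) :
    HasFDerivAt A (LinearMap.toContinuousLinearMap A.linear) u := by
  have h : (A : E → V) = fun w => LinearMap.toContinuousLinearMap A.linear w + A 0 :=
    A.decomp
  rw [h]
  exact (ContinuousLinearMap.hasFDerivAt _).add_const _

theorem hasFDerivAt_comp_of_eqOn_affine (hU : IsOpen U) (hφ : ∀ u ∈ U, φ u = A u) {u : E}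
    (hu : u ∈ U) (hc : DifferentiableAt ℝ c (φ u)) : HasFDerivAt (fun u => c (φ u))
      ((fderiv ℝ c (φ u)).comp (LinearMap.toContinuousLinearMap A.linear)) u := by
  have hc' : HasFDerivAt c (fderiv ℝ c (φ u)) (A u) := by
    rw [← hφ u hu]
    exact hc.hasFDerivAt
  refine (hc'.comp u (A.hasFDerivAt_of_finiteDimensional u)).congr_of_eventuallyEq ?_
  filter_upwards [hU.mem_nhds hu] with w hw
  exact congrArg c (hφ w hw)

theorem fderiv_comp_of_eqOn_affine (hU : IsOpen U) (hφ : ∀ u ∈ U, φ u = A u) {u v : E}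
    (hu : u ∈ U) (hc : DifferentiableAt ℝ c (φ u)) :
    fderiv ℝ (fun u => c (φ u)) u v = fderiv ℝ c (φ u) (A.linear v) := by
  rw [(hasFDerivAt_comp_of_eqOn_affine hU hφ hu hc).fderiv]
  rfl

theorem ConvexOn.comp_of_eqOn_affine {E V : Type*} [AddCommGroup E] [Module ℝ E] [AddCommGroup V]
    [Module ℝ V] {c : V → ℝ} {φ : E → V} {A : E →ᵃ[ℝ] V} {U : Set E} {S : Set V}
    (hc : ConvexOn ℝ S c) (hU : Convex ℝ U) (hφ : ∀ u ∈ U, φ u = A u) (hS : ∀ u ∈ U, φ u ∈ S) :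
    ConvexOn ℝ U fun u => c (φ u) :=
  ((hc.comp_affineMap A).subset (fun u hu => by rw [Set.mem_preimage, ← hφ u hu]; exact hS u hu)
    hU).congr fun u hu => congrArg c (hφ u hu).symm

end AffineSubstitution

/-- An open set contains a ball around each of its points whose radius is a measurable function. -/
theorem IsOpen.exists_measurable_radius {E : Type*} [NormedAddCommGroup E] [MeasurableSpace E]
    [OpensMeasurableSpace E] {U : Set E} (hU : IsOpen U) {r : ℝ} (hr : 0 < r) :
    ∃ ρ : E → ℝ, Measurable ρ ∧ (∀ u, ρ u ≤ r) ∧ (∀ u ∈ U, 0 < ρ u) ∧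
      ∀ u ∈ U, ∀ d, ‖d‖ ≤ ρ u → u + d ∈ U := by
  rcases Set.eq_empty_or_nonempty Uᶜ with h | h
  · refine ⟨fun _ => r, measurable_const, fun _ => le_rfl, fun _ _ => hr, fun u _ d _ => ?_⟩
    rw [Set.compl_empty_iff.1 h]
    trivial
  · have hpos : ∀ u ∈ U, 0 < Metric.infDist u Uᶜ := fun u hu =>
      (hU.isClosed_compl.notMem_iff_infDist_pos h).1 (Set.notMem_compl_iff.2 hu)
    -- Half the distance keeps the closed ball away from the complement.
    refine ⟨fun u => min r (Metric.infDist u Uᶜ / 2),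
      measurable_const.min ((Metric.continuous_infDist_pt _).measurable.div_const _),
      fun _ => min_le_left _ _, fun u hu => lt_min hr (half_pos (hpos u hu)), fun u hu d hd => ?_⟩
    by_contra hud
    have h1 := Metric.infDist_le_dist_of_mem (x := u) (show u + d ∈ Uᶜ from hud)
    rw [dist_self_add_right] at h1
    linarith [hpos u hu, hd.trans (min_le_right _ _)]

/-! ### The cost as a function of one action. -/

namespace NestedGame

variable {N M : ℕ} {Ω₀ : Type*} {W H Y : Fin M → Type*} {n : Fin M → ℕ}
  [MeasurableSpace Ω₀] [∀ k, MeasurableSpace (W k)] [∀ k, MeasurableSpace (H k)]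
  [∀ k, MeasurableSpace (Y k)]

/-- The cost of the player of DM `k` in the dynamic game as a function of the action of DM `k`. -/
noncomputable def dynCost (G : NestedGame N M Ω₀ W H Y n) (γ : ∀ k, G.DynInfo k → Act n k)
    (k : Fin M) (z : Ω₀ × (∀ j, W j)) (u : Act n k) : ℝ :=
  G.c (G.player k) z.1 (G.dynPlay (Function.update γ k fun _ => u) z)

/-- The cost of the player of DM `k` in the static game as a function of the action of DM `k`. -/
noncomputable def statCost (G : NestedGame N M Ω₀ W H Y n) (γ : ∀ k, G.StatInfo k → Act n k)
    (k : Fin M) (z : Ω₀ × (∀ j, W j)) (u : Act n k) : ℝ :=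
  G.c (G.player k) z.1 (G.statPlay (Function.update γ k fun _ => u) z)

/-- The change of the actions in the dynamic game if DM `k` deviates by `b`. -/
noncomputable def dynShift (G : NestedGame N M Ω₀ W H Y n) (γ : ∀ k, G.DynInfo k → Act n k)
    (k : Fin M) (b : G.DynInfo k → Act n k) (z : Ω₀ × (∀ j, W j)) : ∀ j, Act n j :=
  G.dynPlay (Function.update γ k fun y => γ k y + b y) z - G.dynPlay γ z

/-- A policy of the dynamic game and a policy-dependent static reduction of it, with the
assumptions that make their equilibria correspond. -/
structure ReducedPolicy (G : NestedGame N M Ω₀ W H Y n) {Ω : Type*} [MeasurableSpace Ω]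
    (μ : Measure Ω) (ζ : Ω → Ω₀ × (∀ j, W j)) (γD : ∀ k, G.DynInfo k → Act n k)
    (γS : ∀ k, G.StatInfo k → Act n k) : Prop where
  measurable_ζ : Measurable ζ
  invertible : G.InvertibleObs
  smoothConvex : G.SmoothConvexCosts
  proportional : G.ProportionalCosts
  admissible_dyn : ∀ k, G.AdmissibleFor k (γD k)
  conditionC : G.ConditionC μ ζ γD
  finiteCosts : G.FiniteCostsNear μ ζ γD
  admissible_stat : ∀ k, G.AdmissibleFor k (γS k)
  reduction : G.IsStaticReduction μ ζ γD γS

namespace ReducedPolicy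

variable {G : NestedGame N M Ω₀ W H Y n} {Ω : Type*} [MeasurableSpace Ω] {μ : Measure Ω}
  {ζ : Ω → Ω₀ × (∀ j, W j)} {γD : ∀ k, G.DynInfo k → Act n k}
  {γS : ∀ k, G.StatInfo k → Act n k} {k : Fin M}

theorem differentiableAt_cost (h : ReducedPolicy G μ ζ γD γS) (i : Fin N) (ω₀ : Ω₀)
    {u : ∀ k, Act n k} (hu : u ∈ G.actionSet) : DifferentiableAt ℝ (G.c i ω₀) u :=
  ((h.smoothConvex i ω₀).1.differentiableOn one_ne_zero).differentiableAt
    (G.isOpen_actionSet.mem_nhds hu)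

theorem statPlay_mem (h : ReducedPolicy G μ ζ γD γS) (z : Ω₀ × (∀ j, W j)) :
    G.statPlay γS z ∈ G.actionSet := fun k _ => (h.admissible_stat k).2 _

theorem dynPlay_mem (h : ReducedPolicy G μ ζ γD γS) (z : Ω₀ × (∀ j, W j)) :
    G.dynPlay γD z ∈ G.actionSet := NestedGame.dynPlay_mem h.admissible_dyn z

theorem dynPlay_update_mem (h : ReducedPolicy G μ ζ γD γS) {β : G.DynInfo k → Act n k}
    (hβ : G.AdmissibleFor k β) (z : Ω₀ × (∀ j, W j)) :
    G.dynPlay (Function.update γD k β) z ∈ G.actionSet :=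
  NestedGame.dynPlay_mem (admissibleFor_update h.admissible_dyn hβ) z

theorem ae_statPlay_eq (h : ReducedPolicy G μ ζ γD γS) :
    ∀ᵐ x ∂μ, G.statPlay γS (ζ x) = G.dynPlay γD (ζ x) := by
  filter_upwards [ae_all_iff.2 h.reduction] with x hx
  funext k
  rw [dynPlay_eq]
  exact hx k

theorem measurable_statCost (h : ReducedPolicy G μ ζ γD γS) (k : Fin M) :
    Measurable (Function.uncurry (G.statCost γS k)) := by
  have he : Function.uncurry (G.statCost γS k) = fun q => Function.uncurry (G.c (G.player k))
      (q.1.1, Function.update (G.statPlay γS q.1) k q.2) := by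
    funext q
    exact congrArg _ (statPlay_update _ _ _)
  rw [he]
  refine (G.measurable_c (G.player k)).comp ((measurable_fst.comp measurable_fst).prodMk ?_)
  exact measurable_update'.comp (((measurable_statPlay fun k => (h.admissible_stat k).1).comp
    measurable_fst).prodMk measurable_snd)

theorem measurable_dynCost (h : ReducedPolicy G μ ζ γD γS) (k : Fin M) :
    Measurable (Function.uncurry (G.dynCost γD k)) :=
  (G.measurable_c (G.player k)).comp ((measurable_fst.comp measurable_fst).prodMk
    (measurable_dynPlay_update_const (fun k => (h.admissible_dyn k).1) k))

/-- The affine map `u ↦ (p₋ₖ, u)`. -/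
noncomputable def _root_.AffineMap.update (p : ∀ j, Act n j) (k : Fin M) :
    Act n k →ᵃ[ℝ] (∀ j, Act n j) :=
  (LinearMap.single ℝ (Act n) k).toAffineMap + AffineMap.const ℝ _ (Function.update p k 0)

theorem update_eq_affine (p : ∀ j, Act n j) (k : Fin M) (u : Act n k) :
    Function.update p k u = AffineMap.update p k u := by
  funext j
  rcases eq_or_ne j k with rfl | hj
  · simp [AffineMap.update]
  · simp [AffineMap.update, hj]

theorem statPlay_update_mem (h : ReducedPolicy G μ ζ γD γS) (z : Ω₀ × (∀ j, W j)) {u : Act n k}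
    (hu : u ∈ G.U k) : G.statPlay (Function.update γS k fun _ => u) z ∈ G.actionSet := by
  rw [statPlay_update]
  exact (Set.update_mem_pi_iff_of_mem (h.statPlay_mem z)).2 fun _ => hu

theorem convexOn_statCost (h : ReducedPolicy G μ ζ γD γS) (k : Fin M) (z : Ω₀ × (∀ j, W j)) :
    ConvexOn ℝ (G.U k) (G.statCost γS k z) := by
  refine (h.smoothConvex (G.player k) z.1).2.comp_of_eqOn_affine (G.convex_U k)
    (A := AffineMap.update (G.statPlay γS z) k) (fun u _ => ?_)
    fun u hu => h.statPlay_update_mem z hu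
  rw [statPlay_update, update_eq_affine]

theorem differentiableAt_statCost (h : ReducedPolicy G μ ζ γD γS) (z : Ω₀ × (∀ j, W j))
    {u : Act n k} (hu : u ∈ G.U k) : DifferentiableAt ℝ (G.statCost γS k z) u :=
  (hasFDerivAt_comp_of_eqOn_affine (A := AffineMap.update (G.statPlay γS z) k) (G.isOpen_U k)
    (fun u _ => by rw [statPlay_update, update_eq_affine]) hu
    (h.differentiableAt_cost _ _ (h.statPlay_update_mem z hu))).differentiableAt

/-- No DM reacts in the static game, so only the component of `k` moves. -/
theorem fderiv_statCost (h : ReducedPolicy G μ ζ γD γS) (k : Fin M) (z : Ω₀ × (∀ j, W j))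
    (v : Act n k) : fderiv ℝ (G.statCost γS k z) (γS k (G.statObs γS z k)) v =
      fderiv ℝ (G.c (G.player k) z.1) (G.statPlay γS z) (Pi.single k v) := by
  have he : G.statPlay (Function.update γS k fun _ => γS k (G.statObs γS z k)) z =
      G.statPlay γS z := by
    rw [statPlay_update]
    exact Function.update_eq_self _ _
  have hA := fderiv_comp_of_eqOn_affine (A := AffineMap.update (G.statPlay γS z) k)
    (c := G.c (G.player k) z.1) (v := v) (G.isOpen_U k)
    (φ := fun u => G.statPlay (Function.update γS k fun _ => u) z)
    (fun u _ => by rw [statPlay_update, update_eq_affine])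
    ((h.admissible_stat k).2 (G.statObs γS z k))
    (by rw [he]; exact h.differentiableAt_cost _ _ (h.statPlay_mem z))
  rw [he] at hA
  refine hA.trans (congrArg _ ?_)
  simp [AffineMap.update]

end ReducedPolicy

end NestedGame

/-! ### Deviations in the dynamic game and their first-order effect. -/

namespace NestedGame.ReducedPolicy

variable {N M : ℕ} {Ω₀ : Type*} {W H Y : Fin M → Type*} {n : Fin M → ℕ}
  [MeasurableSpace Ω₀] [∀ k, MeasurableSpace (W k)] [∀ k, MeasurableSpace (H k)]
  [∀ k, MeasurableSpace (Y k)] {G : NestedGame N M Ω₀ W H Y n} {Ω : Type*} [MeasurableSpace Ω]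
  {μ : Measure Ω} {ζ : Ω → Ω₀ × (∀ j, W j)} {γD : ∀ k, G.DynInfo k → Act n k}
  {γS : ∀ k, G.StatInfo k → Act n k} {k : Fin M}

/-- `ρ` bounds deviations of DM `k` in the dynamic game that keep all expected costs finite. -/
structure DynRadius (G : NestedGame N M Ω₀ W H Y n) (μ : Measure Ω) (ζ : Ω → Ω₀ × (∀ j, W j))
    (γD : ∀ k, G.DynInfo k → Act n k) (k : Fin M) (ρ : G.DynInfo k → ℝ) : Prop where
  measurable : Measurable ρ
  pos : ∀ y, 0 < ρ y
  add_mem : ∀ y d, ‖d‖ ≤ ρ y → γD k y + d ∈ G.U k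
  integrable : ∀ b : G.DynInfo k → Act n k, Measurable b → (∀ y, ‖b y‖ ≤ ρ y) →
    Integrable (fun x => G.c (G.player k) (ζ x).1
      (G.dynPlay (Function.update γD k fun y => γD k y + b y) (ζ x))) μ ∧
    ∀ j, Integrable (fun x => G.c (G.player k) (ζ x).1 (Function.update (G.dynPlay γD (ζ x)) j
      (G.dynPlay (Function.update γD k fun y => γD k y + b y) (ζ x) j))) μ

/-- The constant radius of the finite-cost assumption shrinks, measurably in the action, near the
boundary of `G.U k`. -/
theorem exists_dynRadius (h : ReducedPolicy G μ ζ γD γS) (k : Fin M) :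
    ∃ ρ, DynRadius G μ ζ γD k ρ := by
  obtain ⟨r, hr, hint⟩ := h.finiteCosts k
  obtain ⟨ρ, hm, hle, hpos, hadd⟩ := (G.isOpen_U k).exists_measurable_radius hr
  have hγ := h.admissible_dyn k
  refine ⟨fun y => ρ (γD k y), hm.comp hγ.1, fun y => hpos _ (hγ.2 y),
    fun y d hd => hadd _ (hγ.2 y) d hd, fun b hb hbρ => hint _ ⟨hγ.1.add hb,
      fun y => hadd _ (hγ.2 y) _ (hbρ y)⟩ fun y => ?_⟩
  rw [add_sub_cancel_left]
  exact (hbρ y).trans (hle _)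

theorem DynRadius.admissible (h : ReducedPolicy G μ ζ γD γS) {ρ : G.DynInfo k → ℝ}
    (hρ : DynRadius G μ ζ γD k ρ) {b : G.DynInfo k → Act n k} (hb : Measurable b)
    (hbρ : ∀ y, ‖b y‖ ≤ ρ y) : G.AdmissibleFor k fun y => γD k y + b y :=
  ⟨(h.admissible_dyn k).1.add hb, fun y => hρ.add_mem y _ (hbρ y)⟩

theorem dynShift_self (b : G.DynInfo k → Act n k) (z : Ω₀ × (∀ j, W j)) :
    G.dynShift γD k b z k = b (G.dynObs γD z k) := by
  rw [dynShift, Pi.sub_apply, dynPlay_update_self, dynPlay_eq, add_sub_cancel_left]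

theorem dynShift_of_notMem (b : G.DynInfo k → Act n k) (z : Ω₀ × (∀ j, W j)) {j : Fin M}
    (hjk : j ≠ k) (hj : k ∉ G.down j) : G.dynShift γD k b z j = 0 := by
  rw [dynShift, Pi.sub_apply, dynPlay_update_of_notMem _ _ hjk hj, sub_self]

theorem measurable_dynShift (h : ReducedPolicy G μ ζ γD γS) {b : G.DynInfo k → Act n k}
    (hb : Measurable b) : Measurable (G.dynShift γD k b) := by
  have hγ : ∀ j, Measurable (γD j) := fun j => (h.admissible_dyn j).1
  refine (measurable_dynPlay fun j => ?_).sub (measurable_dynPlay hγ)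
  rcases eq_or_ne j k with rfl | hj
  · rw [Function.update_self]
    exact (hγ j).add hb
  · rw [Function.update_of_ne hj]
    exact hγ j

theorem add_single_dynShift (b : G.DynInfo k → Act n k) (z : Ω₀ × (∀ j, W j)) (j : Fin M) :
    G.dynPlay γD z + Pi.single j (G.dynShift γD k b z j) = Function.update (G.dynPlay γD z) j
      (G.dynPlay (Function.update γD k fun y => γD k y + b y) z j) := by
  funext i
  rcases eq_or_ne i j with rfl | hi
  · simp [dynShift]
  · simp [hi]

/-- The dynamic game responds affinely to deviations of a single DM. -/
def AffineResponse (G : NestedGame N M Ω₀ W H Y n) (γD : ∀ k, G.DynInfo k → Act n k)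
    (k : Fin M) (z : Ω₀ × (∀ j, W j)) : Prop :=
  ∃ A : Act n k →ᵃ[ℝ] (∀ j, Act n j), ∀ u ∈ G.U k,
    G.dynPlay (Function.update γD k fun _ => u) z = A u

theorem AffineResponse.convexOn (h : ReducedPolicy G μ ζ γD γS) {z : Ω₀ × (∀ j, W j)}
    (hA : AffineResponse G γD k z) : ConvexOn ℝ (G.U k) (G.dynCost γD k z) := by
  obtain ⟨A, hA⟩ := hA
  exact (h.smoothConvex (G.player k) z.1).2.comp_of_eqOn_affine (G.convex_U k) hA
    fun u hu => h.dynPlay_update_mem ⟨measurable_const, fun _ => hu⟩ z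

theorem AffineResponse.differentiableAt (h : ReducedPolicy G μ ζ γD γS) {z : Ω₀ × (∀ j, W j)}
    (hA : AffineResponse G γD k z) {u : Act n k} (hu : u ∈ G.U k) :
    DifferentiableAt ℝ (G.dynCost γD k z) u := by
  obtain ⟨A, hA⟩ := hA
  exact (hasFDerivAt_comp_of_eqOn_affine (G.isOpen_U k) hA hu (h.differentiableAt_cost _ _
    (h.dynPlay_update_mem ⟨measurable_const, fun _ => hu⟩ z))).differentiableAt

theorem AffineResponse.linear_eq {z : Ω₀ × (∀ j, W j)} {A : Act n k →ᵃ[ℝ] (∀ j, Act n j)}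
    (h : ReducedPolicy G μ ζ γD γS)
    (hA : ∀ u ∈ G.U k, G.dynPlay (Function.update γD k fun _ => u) z = A u)
    (b : G.DynInfo k → Act n k)
    (hb : γD k (G.dynObs γD z k) + b (G.dynObs γD z k) ∈ G.U k) :
    A.linear (b (G.dynObs γD z k)) = G.dynShift γD k b z := by
  have h1 := hA _ hb
  have h2 := hA _ ((h.admissible_dyn k).2 (G.dynObs γD z k))
  rw [dynPlay_update_const_self] at h2
  have h3 := dynPlay_update_const (γ := γD) (fun y => γD k y + b y) z
  rw [dynShift, ← h3, h1, h2]
  have h4 := A.map_vadd (γD k (G.dynObs γD z k)) (b (G.dynObs γD z k))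
  rw [vadd_eq_add, vadd_eq_add, add_comm] at h4
  rw [h4, add_sub_cancel_right]

/-- The chain rule: the linear part of the affine response maps the deviation to the change of the
whole action profile. -/
theorem AffineResponse.fderiv_dynCost (h : ReducedPolicy G μ ζ γD γS) {z : Ω₀ × (∀ j, W j)}
    (hA : AffineResponse G γD k z) (b : G.DynInfo k → Act n k)
    (hb : γD k (G.dynObs γD z k) + b (G.dynObs γD z k) ∈ G.U k) :
    fderiv ℝ (G.dynCost γD k z) (γD k (G.dynObs γD z k)) (b (G.dynObs γD z k)) =
      fderiv ℝ (G.c (G.player k) z.1) (G.dynPlay γD z) (G.dynShift γD k b z) := by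
  obtain ⟨A, hA⟩ := hA
  have he := dynPlay_update_const_self γD z k
  have hf := fderiv_comp_of_eqOn_affine (A := A) (c := G.c (G.player k) z.1)
    (v := b (G.dynObs γD z k)) (G.isOpen_U k)
    (φ := fun u => G.dynPlay (Function.update γD k fun _ => u) z) hA
    ((h.admissible_dyn k).2 (G.dynObs γD z k))
    (by rw [he]; exact h.differentiableAt_cost _ _ (h.dynPlay_mem z))
  rw [he, AffineResponse.linear_eq h hA b hb] at hf
  exact hf

/-- The finite-cost assumption speaks of actual deviations only. Linearity identifies the backward
point, which the convexity bounds need, with the effect of the deviation `-b`. -/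
theorem AffineResponse.dynShift_neg (h : ReducedPolicy G μ ζ γD γS) {z : Ω₀ × (∀ j, W j)}
    (hA : AffineResponse G γD k z) (b : G.DynInfo k → Act n k)
    (hb : γD k (G.dynObs γD z k) + b (G.dynObs γD z k) ∈ G.U k)
    (hb' : γD k (G.dynObs γD z k) + -b (G.dynObs γD z k) ∈ G.U k) :
    G.dynShift γD k (fun y => -b y) z = -G.dynShift γD k b z := by
  obtain ⟨A, hA⟩ := hA
  rw [← AffineResponse.linear_eq h hA b hb, ← AffineResponse.linear_eq h hA (fun y => -b y) hb',
    map_neg]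

section StandardBorel

variable [StandardBorelSpace Ω₀] [Nonempty Ω₀] [∀ k, StandardBorelSpace (W k)]
  [∀ k, Nonempty (W k)] [IsFiniteMeasure μ]

/-- Stated for the law of `ζ`, so that convexity passes to the conditional distributions. -/
theorem ae_map_affineResponse (h : ReducedPolicy G μ ζ γD γS) (k : Fin M) :
    ∀ᵐ z ∂(μ.map ζ), AffineResponse G γD k z :=
  (h.conditionC.ae_map h.measurable_ζ h.admissible_dyn).mono fun z hz =>
    exists_affineMap_dynPlay h.admissible_dyn z hz k

theorem ae_affineResponse (h : ReducedPolicy G μ ζ γD γS) (k : Fin M) :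
    ∀ᵐ x ∂μ, AffineResponse G γD k (ζ x) :=
  ae_of_ae_map h.measurable_ζ.aemeasurable (h.ae_map_affineResponse k)

theorem DynRadius.convexDecision (h : ReducedPolicy G μ ζ γD γS) {ρ : G.DynInfo k → ℝ}
    (hρ : DynRadius G μ ζ γD k ρ) :
    ConvexDecision μ ζ (fun z => G.dynObs γD z k) (G.dynCost γD k) (G.U k) (γD k) ρ where
  measurable_ζ := h.measurable_ζ
  measurable_Y := measurable_dynObs (fun k => (h.admissible_dyn k).1) k
  measurable_f := h.measurable_dynCost k
  measurable_γ := (h.admissible_dyn k).1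
  measurable_ρ := hρ.measurable
  convexOn := (h.ae_map_affineResponse k).mono fun _ hz => AffineResponse.convexOn h hz
  differentiableAt := (h.ae_map_affineResponse k).mono fun _ hz _ hu =>
    AffineResponse.differentiableAt h hz hu
  ρ_pos := hρ.pos
  add_mem := hρ.add_mem
  integrable := fun b hb hbρ => (hρ.integrable b hb hbρ).1.congr (.of_forall fun x =>
    congrArg (G.c (G.player k) (ζ x).1)
      (dynPlay_update_const (fun y => γD k y + b y) (ζ x)).symm)

/-- The derivative of the cost in the direction of the response of a single DM to a small deviation
is integrable. -/
theorem DynRadius.integrable_fderiv_single (h : ReducedPolicy G μ ζ γD γS)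
    {ρ : G.DynInfo k → ℝ} (hρ : DynRadius G μ ζ γD k ρ) {b : G.DynInfo k → Act n k}
    (hb : Measurable b) (hbρ : ∀ y, ‖b y‖ ≤ ρ y) (j : Fin M) :
    Integrable (fun x => fderiv ℝ (G.c (G.player k) (ζ x).1) (G.dynPlay γD (ζ x))
      (Pi.single j (G.dynShift γD k b (ζ x) j))) μ := by
  have hnegρ : ∀ y, ‖-b y‖ ≤ ρ y := fun y => by rw [norm_neg]; exact hbρ y
  have hγ : ∀ j, Measurable (γD j) := fun j => (h.admissible_dyn j).1
  have hP : Measurable fun x => G.dynPlay γD (ζ x) := (measurable_dynPlay hγ).comp h.measurable_ζ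
  have hD : Measurable fun x => (Pi.single j (G.dynShift γD k b (ζ x) j) : ∀ j, Act n j) := by
    have h1 : Measurable fun x => G.dynShift γD k b (ζ x) j :=
      (measurable_pi_apply j).comp ((h.measurable_dynShift hb).comp h.measurable_ζ)
    exact (measurable_update (0 : ∀ j, Act n j)).comp h1
  have hneg : ∀ᵐ x ∂μ, G.dynPlay γD (ζ x) - Pi.single j (G.dynShift γD k b (ζ x) j) =
      Function.update (G.dynPlay γD (ζ x)) j
        (G.dynPlay (Function.update γD k fun y => γD k y + -b y) (ζ x) j) := by
    filter_upwards [h.ae_affineResponse k] with x hx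
    rw [← add_single_dynShift (fun y => -b y), AffineResponse.dynShift_neg h hx b
      (hρ.add_mem _ _ (hbρ _)) (hρ.add_mem _ _ (hnegρ _)), Pi.neg_apply, Pi.single_neg,
      sub_eq_add_neg]
  have hmem : ∀ {b : G.DynInfo k → Act n k}, Measurable b → (∀ y, ‖b y‖ ≤ ρ y) → ∀ x,
      Function.update (G.dynPlay γD (ζ x)) j
        (G.dynPlay (Function.update γD k fun y => γD k y + b y) (ζ x) j) ∈ G.actionSet :=
    fun hb hbρ x => (Set.update_mem_pi_iff_of_mem (h.dynPlay_mem (ζ x))).2 fun _ =>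
      h.dynPlay_update_mem (hρ.admissible h hb hbρ) (ζ x) j trivial
  refine integrable_fderiv_apply (F := fun x => G.c (G.player k) (ζ x).1) (S := G.actionSet)
    ((G.measurable_c _).comp (((measurable_fst.comp h.measurable_ζ).comp measurable_fst).prodMk
      measurable_snd)) hP hD
    (.of_forall fun x => h.differentiableAt_cost _ _ (h.dynPlay_mem _))
    (.of_forall fun x => (h.smoothConvex _ _).2) (.of_forall fun x => h.dynPlay_mem _)
    (.of_forall fun x => ?_) ?_ ?_ ?_ ?_
  · rw [add_single_dynShift]
    exact hmem hb hbρ x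
  · filter_upwards [hneg] with x hx
    rw [hx]
    exact hmem hb.neg hnegρ x
  · simpa using (hρ.integrable (fun _ => 0) measurable_const
      (fun y => by rw [norm_zero]; exact (hρ.pos y).le)).1
  · simp_rw [add_single_dynShift]
    exact (hρ.integrable b hb hbρ).2 j
  · refine ((hρ.integrable (fun y => -b y) hb.neg hnegρ).2 j).congr ?_
    filter_upwards [hneg] with x hx
    rw [hx]

end StandardBorel

end NestedGame.ReducedPolicy

/-! ### Comparison of the first-order conditions of the two games. -/

namespace NestedGame.ReducedPolicy

variable {N M : ℕ} {Ω₀ : Type*} {W H Y : Fin M → Type*} {n : Fin M → ℕ}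
  [MeasurableSpace Ω₀] [∀ k, MeasurableSpace (W k)] [∀ k, MeasurableSpace (H k)]
  [∀ k, MeasurableSpace (Y k)] {G : NestedGame N M Ω₀ W H Y n} {Ω : Type*} [MeasurableSpace Ω]
  {μ : Measure Ω} {ζ : Ω → Ω₀ × (∀ j, W j)} {γD : ∀ k, G.DynInfo k → Act n k}
  {γS : ∀ k, G.StatInfo k → Act n k} {k : Fin M}

/-- The first-order condition of DM `k` in the static game. -/
def StatFirstOrder (G : NestedGame N M Ω₀ W H Y n) (μ : Measure Ω) (ζ : Ω → Ω₀ × (∀ j, W j))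
    (γS : ∀ k, G.StatInfo k → Act n k) (k : Fin M) : Prop :=
  ConvexDecision.FirstOrder μ ζ (fun z => G.statObs γS z k) (G.statCost γS k) (γS k)

/-- The first-order condition of DM `k` in the dynamic game. -/
def DynFirstOrder (G : NestedGame N M Ω₀ W H Y n) (μ : Measure Ω) (ζ : Ω → Ω₀ × (∀ j, W j))
    (γD : ∀ k, G.DynInfo k → Act n k) (k : Fin M) : Prop :=
  ConvexDecision.FirstOrder μ ζ (fun z => G.dynObs γD z k) (G.dynCost γD k) (γD k)

theorem ae_fderiv_statCost (h : ReducedPolicy G μ ζ γD γS) (k : Fin M)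
    (v : (Ω₀ × (∀ j, W j)) → Act n k) :
    ∀ᵐ x ∂μ, fderiv ℝ (G.statCost γS k (ζ x)) (γS k (G.statObs γS (ζ x) k)) (v (ζ x)) =
      fderiv ℝ (G.c (G.player k) (ζ x).1) (G.dynPlay γD (ζ x)) (Pi.single k (v (ζ x))) := by
  filter_upwards [h.ae_statPlay_eq] with x hx
  rw [h.fderiv_statCost, hx]

/-- Costs are proportional on the open action set only, which is a neighbourhood of the actions
played. -/
theorem fderiv_cost_eq_mul (h : ReducedPolicy G μ ζ γD γS) {j : Fin M} (hj : k ∈ G.down j) :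
    ∃ α : ℝ, ∀ z d, fderiv ℝ (G.c (G.player k) z.1) (G.dynPlay γD z) d =
      α * fderiv ℝ (G.c (G.player j) z.1) (G.dynPlay γD z) d := by
  obtain ⟨α, hα⟩ := h.proportional (G.player k) (G.player j) ⟨k, j, rfl, rfl, hj⟩
  refine ⟨α, fun z d => ?_⟩
  have hev : G.c (G.player k) z.1 =ᶠ[𝓝 (G.dynPlay γD z)] fun u => α * G.c (G.player j) z.1 u := by
    filter_upwards [G.isOpen_actionSet.mem_nhds (h.dynPlay_mem z)] with u hu using hα z.1 u hu
  rw [hev.fderiv_eq, fderiv_const_mul (h.differentiableAt_cost _ _ (h.dynPlay_mem z))]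
  rfl

/-- Nestedness makes the reaction of `j` an admissible direction for `j` in the static game: its
actions with and without the deviation are both determined by its static information. -/
theorem exists_dynShift_eq [StandardBorelSpace Ω₀] [∀ k, StandardBorelSpace (W k)]
    [∀ k, StandardBorelSpace (H k)] (h : ReducedPolicy G μ ζ γD γS)
    {b : G.DynInfo k → Act n k} (hb : Measurable b) (j : Fin M) :
    ∃ δ : G.StatInfo j → Act n j, Measurable δ ∧
      ∀ z, δ (G.statObs γS z j) = G.dynShift γD k b z j :=
  (measurable_statObs γS j).exists_measurable_comp_of_factorsThrough
    ((measurable_pi_apply j).comp (h.measurable_dynShift hb)) fun z z' hz => by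
      change G.dynPlay _ z j - G.dynPlay _ z j = G.dynPlay _ z' j - G.dynPlay _ z' j
      rw [dynPlay_congr γD fun m => congrFun hz m, dynPlay_congr _ fun m => congrFun hz m]

variable [StandardBorelSpace Ω₀] [Nonempty Ω₀] [∀ k, StandardBorelSpace (W k)]
  [∀ k, Nonempty (W k)]

theorem isStationary_dyn_iff [IsFiniteMeasure μ] (h : ReducedPolicy G μ ζ γD γS) :
    G.IsStationary μ ζ G.dynPlay G.dynObs γD ↔ ∀ k, DynFirstOrder G μ ζ γD k := by
  refine forall_congr' fun k => ?_
  obtain ⟨ρ, hρ⟩ := h.exists_dynRadius k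
  exact (DynRadius.convexDecision h hρ).stationary_iff_firstOrder

theorem isDMNash_dyn_iff [IsFiniteMeasure μ] (h : ReducedPolicy G μ ζ γD γS) :
    G.IsDMNash μ ζ G.dynPlay γD ↔ ∀ k, DynFirstOrder G μ ζ γD k := by
  refine forall_congr' fun k => ?_
  obtain ⟨ρ, hρ⟩ := h.exists_dynRadius k
  rw [DynFirstOrder, ← (DynRadius.convexDecision h hρ).optimal_iff_firstOrder,
    ConvexDecision.Optimal]
  simp only [dynCost, dynPlay_update_const_self]
  simp_rw [dynPlay_update_const]
  rfl

theorem exists_dynInfo_of_statInfo [∀ k, StandardBorelSpace (H k)] [∀ k, StandardBorelSpace (Y k)]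
    (h : ReducedPolicy G μ ζ γD γS) (k : Fin M) :
    ∃ Φ : G.StatInfo k → G.DynInfo k, Measurable Φ ∧
      ∀ z, Φ (G.statObs γS z k) = G.dynObs γD z k :=
  have : Nonempty (G.DynInfo k) := ⟨G.dynObs γD (Classical.arbitrary _) k⟩
  (measurable_statObs γS k).exists_measurable_comp_of_factorsThrough
    (measurable_dynObs (fun k => (h.admissible_dyn k).1) k)
    fun _ _ hz => dynObs_congr γD fun m => congrFun hz m

/-- This direction of the equivalence of information needs invertibility; the converse does not. -/
theorem exists_statInfo_of_dynInfo [∀ k, StandardBorelSpace (H k)] [∀ k, StandardBorelSpace (Y k)]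
    (h : ReducedPolicy G μ ζ γD γS) (k : Fin M) :
    ∃ φ : G.DynInfo k → G.StatInfo k, Measurable φ ∧
      ∀ z, φ (G.dynObs γD z k) = G.statObs γS z k :=
  have : Nonempty (G.StatInfo k) := ⟨G.statObs γS (Classical.arbitrary _) k⟩
  (measurable_dynObs (fun k => (h.admissible_dyn k).1) k).exists_measurable_comp_of_factorsThrough
    (measurable_statObs γS k)
    fun _ _ hz => funext fun m => h_eq_of_dynObs_eq h.invertible h.admissible_dyn hz m

variable [∀ k, StandardBorelSpace (H k)]

/-- The response of a later DM `j`, whose first-order condition holds in the static game, does not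
contribute to the first-order effect of a deviation of DM `k`. -/
theorem integral_fderiv_single_eq_zero [IsFiniteMeasure μ] (h : ReducedPolicy G μ ζ γD γS)
    {ρ : G.DynInfo k → ℝ} (hρ : DynRadius G μ ζ γD k ρ) {b : G.DynInfo k → Act n k}
    (hb : Measurable b) (hbρ : ∀ y, ‖b y‖ ≤ ρ y) {j : Fin M} (hj : k ∈ G.down j)
    (hS : StatFirstOrder G μ ζ γS j) :
    ∫ x, fderiv ℝ (G.c (G.player k) (ζ x).1) (G.dynPlay γD (ζ x))
      (Pi.single j (G.dynShift γD k b (ζ x) j)) ∂μ = 0 := by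
  obtain ⟨α, hα⟩ := h.fderiv_cost_eq_mul hj
  have hI := DynRadius.integrable_fderiv_single h hρ hb hbρ j
  simp_rw [hα] at hI ⊢
  rw [integral_const_mul]
  -- The first-order condition of `j` requires integrability of the derivative of its own player's
  -- cost, which follows from that of the multiple only if `α ≠ 0`.
  rcases eq_or_ne α 0 with rfl | hα0
  · rw [zero_mul]
  obtain ⟨δ, hδ, hδeq⟩ := h.exists_dynShift_eq hb j
  have he := h.ae_fderiv_statCost j fun z => δ (G.statObs γS z j)
  simp_rw [hδeq] at he
  have h0 := hS δ hδ
  simp_rw [hδeq] at h0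
  rw [integral_congr_ae he, integrable_congr he] at h0
  rw [h0 ((integrable_const_mul_iff (IsUnit.mk0 α hα0) _).1 hI), mul_zero]

/-- The first-order effect of a deviation of DM `k` in the dynamic game is the one in the static
game if the first-order conditions of the later DMs hold in the static game. -/
theorem integral_fderiv_dynCost [IsFiniteMeasure μ] (h : ReducedPolicy G μ ζ γD γS)
    {ρ : G.DynInfo k → ℝ} (hρ : DynRadius G μ ζ γD k ρ) {b : G.DynInfo k → Act n k}
    (hb : Measurable b) (hbρ : ∀ y, ‖b y‖ ≤ ρ y)
    (hS : ∀ j, k ∈ G.down j → StatFirstOrder G μ ζ γS j) :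
    ∫ x, fderiv ℝ (G.dynCost γD k (ζ x)) (γD k (G.dynObs γD (ζ x) k))
        (b (G.dynObs γD (ζ x) k)) ∂μ =
      ∫ x, fderiv ℝ (G.c (G.player k) (ζ x).1) (G.dynPlay γD (ζ x))
        (Pi.single k (b (G.dynObs γD (ζ x) k))) ∂μ := by
  have h1 : ∀ᵐ x ∂μ, fderiv ℝ (G.dynCost γD k (ζ x)) (γD k (G.dynObs γD (ζ x) k))
      (b (G.dynObs γD (ζ x) k)) = ∑ j, fderiv ℝ (G.c (G.player k) (ζ x).1) (G.dynPlay γD (ζ x))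
        (Pi.single j (G.dynShift γD k b (ζ x) j)) := by
    filter_upwards [h.ae_affineResponse k] with x hx
    rw [AffineResponse.fderiv_dynCost h hx b (hρ.add_mem _ _ (hbρ _)), ← map_sum,
      Finset.univ_sum_single]
  -- Each component is integrable by itself, so the expectation splits. The terms of later DMs
  -- vanish by their static conditions, all others except that of `k` because there is no reaction.
  rw [integral_congr_ae h1, integral_finsetSum _ fun j _ =>
    DynRadius.integrable_fderiv_single h hρ hb hbρ j, Finset.sum_eq_single k]
  · simp_rw [dynShift_self]
  · intro j _ hjk
    by_cases hj : k ∈ G.down j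
    · exact h.integral_fderiv_single_eq_zero hρ hb hbρ hj (hS j hj)
    · simp_rw [dynShift_of_notMem b _ hjk hj, Pi.single_zero, map_zero, integral_zero]
  · simp

variable [∀ k, StandardBorelSpace (Y k)]

/-- Small directions in the static game are directions in the dynamic game. -/
theorem exists_dyn_direction (h : ReducedPolicy G μ ζ γD γS) {ρ : G.DynInfo k → ℝ}
    (hρ : DynRadius G μ ζ γD k ρ) {Φ : G.StatInfo k → G.DynInfo k}
    (hΦ : ∀ z, Φ (G.statObs γS z k) = G.dynObs γD z k) {b : G.StatInfo k → Act n k}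
    (hb : Measurable b) (hbρ : ∀ s, ‖b s‖ ≤ ρ (Φ s)) :
    ∃ b' : G.DynInfo k → Act n k, Measurable b' ∧ (∀ y, ‖b' y‖ ≤ ρ y) ∧
      ∀ z, b' (G.dynObs γD z k) = b (G.statObs γS z k) := by
  obtain ⟨φ, hφ, hφeq⟩ := h.exists_statInfo_of_dynInfo k
  -- The bound is known only at information that can occur; elsewhere the direction is cut to zero.
  let A : Set (G.DynInfo k) := {y | ‖b (φ y)‖ ≤ ρ y}
  have hA : MeasurableSet A := measurableSet_le (hb.comp hφ).norm hρ.measurable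
  refine ⟨A.indicator fun y => b (φ y), (hb.comp hφ).indicator hA, fun y => ?_, fun z => ?_⟩
  · by_cases hy : y ∈ A
    · rw [Set.indicator_of_mem hy]
      exact hy
    · rw [Set.indicator_of_notMem hy, norm_zero]
      exact (hρ.pos y).le
  · have hz : G.dynObs γD z k ∈ A := by
      have := hbρ (G.statObs γS z k)
      rw [hΦ] at this
      change ‖b (φ _)‖ ≤ _
      rwa [hφeq]
    rw [Set.indicator_of_mem hz, hφeq]

/-- A small static deviation of `k` is a dynamic one, and the finite-cost assumption with `j = k`
covers the case in which nobody reacts. The radius also involves `γS`, since it agrees with the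
dynamic policy only almost surely, whereas actions must stay in `G.U k` for all information. -/
theorem exists_statRadius (h : ReducedPolicy G μ ζ γD γS) {ρ : G.DynInfo k → ℝ}
    (hρ : DynRadius G μ ζ γD k ρ) {Φ : G.StatInfo k → G.DynInfo k} (hΦm : Measurable Φ)
    (hΦ : ∀ z, Φ (G.statObs γS z k) = G.dynObs γD z k) :
    ∃ ρS : G.StatInfo k → ℝ, (∀ s, ρS s ≤ ρ (Φ s)) ∧
      ConvexDecision μ ζ (fun z => G.statObs γS z k) (G.statCost γS k) (G.U k) (γS k) ρS := by
  obtain ⟨r, hm, -, hpos, hadd⟩ := (G.isOpen_U k).exists_measurable_radius one_pos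
  have hγ := h.admissible_stat k
  refine ⟨fun s => min (r (γS k s)) (ρ (Φ s)), fun s => min_le_right _ _, h.measurable_ζ,
    measurable_statObs γS k, h.measurable_statCost k, hγ.1,
    (hm.comp hγ.1).min (hρ.measurable.comp hΦm), .of_forall fun z => h.convexOn_statCost k z,
    .of_forall fun z u hu => h.differentiableAt_statCost z hu,
    fun s => lt_min (hpos _ (hγ.2 s)) (hρ.pos _),
    fun s d hd => hadd _ (hγ.2 s) d (hd.trans (min_le_left _ _)), fun b hb hbρ => ?_⟩
  obtain ⟨b', hb', hbρ', he⟩ := h.exists_dyn_direction hρ hΦ hb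
    fun s => (hbρ s).trans (min_le_right _ _)
  refine ((hρ.integrable b' hb' hbρ').2 k).congr ?_
  filter_upwards [h.ae_statPlay_eq] with x hx
  have hk : G.dynPlay (Function.update γD k fun y => γD k y + b' y) (ζ x) k =
      γS k (G.statObs γS (ζ x) k) + b (G.statObs γS (ζ x) k) := by
    rw [dynPlay_update_self, he, ← G.dynPlay_eq γD (ζ x) k, ← hx]
    rfl
  rw [statCost, statPlay_update, hx, hk]

theorem dynFirstOrder_of_statFirstOrder [IsFiniteMeasure μ] (h : ReducedPolicy G μ ζ γD γS)
    (hS : ∀ j, j = k ∨ k ∈ G.down j → StatFirstOrder G μ ζ γS j) :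
    DynFirstOrder G μ ζ γD k := by
  obtain ⟨ρ, hρ⟩ := h.exists_dynRadius k
  obtain ⟨Φ, hΦm, hΦ⟩ := h.exists_dynInfo_of_statInfo k
  refine (DynRadius.convexDecision h hρ).firstOrder_of_bounded fun b hb hbρ => ?_
  rw [h.integral_fderiv_dynCost hρ hb hbρ fun j hj => hS j (Or.inr hj)]
  have hI := DynRadius.integrable_fderiv_single h hρ hb hbρ k
  simp_rw [dynShift_self] at hI
  have he := h.ae_fderiv_statCost k fun z => b (Φ (G.statObs γS z k))
  simp_rw [hΦ] at he
  have h0 := hS k (Or.inl rfl) _ (hb.comp hΦm)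
  simp_rw [Function.comp_apply, hΦ] at h0
  rw [integral_congr_ae he, integrable_congr he] at h0
  exact h0 hI

/-- A small static direction is carried to a dynamic one, whose first-order effect is the static
effect because the reactions of later DMs contribute nothing. -/
theorem statFirstOrder_of_dynFirstOrder [IsFiniteMeasure μ] (h : ReducedPolicy G μ ζ γD γS)
    (hS : ∀ j, k ∈ G.down j → StatFirstOrder G μ ζ γS j) (hD : DynFirstOrder G μ ζ γD k) :
    StatFirstOrder G μ ζ γS k := by
  obtain ⟨ρ, hρ⟩ := h.exists_dynRadius k
  obtain ⟨Φ, hΦm, hΦ⟩ := h.exists_dynInfo_of_statInfo k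
  obtain ⟨ρS, hle, hdec⟩ := h.exists_statRadius hρ hΦm hΦ
  refine hdec.firstOrder_of_bounded fun b hb hbρ => ?_
  obtain ⟨b', hb', hbρ', he⟩ := h.exists_dyn_direction hρ hΦ hb fun s => (hbρ s).trans (hle s)
  rw [integral_congr_ae (h.ae_fderiv_statCost k fun z => b (G.statObs γS z k))]
  simp_rw [← he]
  rw [← h.integral_fderiv_dynCost hρ hb' hbρ' hS]
  exact hD b' hb' ((DynRadius.convexDecision h hρ).integrable_fderiv hb' hbρ')

theorem forall_dynFirstOrder_iff [IsFiniteMeasure μ] (h : ReducedPolicy G μ ζ γD γS) :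
    (∀ k, DynFirstOrder G μ ζ γD k) ↔ ∀ k, StatFirstOrder G μ ζ γS k := by
  refine ⟨fun hD k => ?_, fun hS k => h.dynFirstOrder_of_statFirstOrder fun j _ => hS j⟩
  -- Backward in the order of play: the static condition of `k` uses those of the DMs that `k`
  -- precedes.
  induction k using WellFoundedGT.induction with
  | ind k ih => exact h.statFirstOrder_of_dynFirstOrder (fun j hj => ih j (G.down_lt hj)) (hD k)

theorem isStationary_stat_iff [IsFiniteMeasure μ] (h : ReducedPolicy G μ ζ γD γS) :
    G.IsStationary μ ζ G.statPlay G.statObs γS ↔ ∀ k, StatFirstOrder G μ ζ γS k := by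
  refine forall_congr' fun k => ?_
  obtain ⟨ρ, hρ⟩ := h.exists_dynRadius k
  obtain ⟨Φ, hΦm, hΦ⟩ := h.exists_dynInfo_of_statInfo k
  obtain ⟨ρS, -, hdec⟩ := h.exists_statRadius hρ hΦm hΦ
  exact hdec.stationary_iff_firstOrder

theorem isDMNash_stat_iff [IsFiniteMeasure μ] (h : ReducedPolicy G μ ζ γD γS) :
    G.IsDMNash μ ζ G.statPlay γS ↔ ∀ k, StatFirstOrder G μ ζ γS k := by
  refine forall_congr' fun k => ?_
  obtain ⟨ρ, hρ⟩ := h.exists_dynRadius k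
  obtain ⟨Φ, hΦm, hΦ⟩ := h.exists_dynInfo_of_statInfo k
  obtain ⟨ρS, -, hdec⟩ := h.exists_statRadius hρ hΦm hΦ
  have he : ∀ z, Function.update (G.statPlay γS z) k (γS k (G.statObs γS z k)) =
      G.statPlay γS z := fun z => Function.update_eq_self _ _
  rw [StatFirstOrder, ← hdec.optimal_iff_firstOrder, ConvexDecision.Optimal]
  simp only [statCost, statPlay_update, he]
  rfl

end NestedGame.ReducedPolicy

theorem mainTheorem2 {N M : ℕ} {Ω₀ : Type*} {W H Y : Fin M → Type*} {n : Fin M → ℕ}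
    [MeasurableSpace Ω₀] [StandardBorelSpace Ω₀] [Nonempty Ω₀]
    [∀ k, MeasurableSpace (W k)] [∀ k, StandardBorelSpace (W k)] [∀ k, Nonempty (W k)]
    [∀ k, MeasurableSpace (H k)] [∀ k, StandardBorelSpace (H k)]
    [∀ k, MeasurableSpace (Y k)] [∀ k, StandardBorelSpace (Y k)]
    {Ω : Type*} [MeasurableSpace Ω] (μ : Measure Ω) [IsProbabilityMeasure μ]
    (G : NestedGame N M Ω₀ W H Y n)
    (ζ : Ω → Ω₀ × (∀ j, W j)) (hζ : Measurable ζ)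
    (hinv : G.InvertibleObs) (hcost : G.SmoothConvexCosts) (hprop : G.ProportionalCosts)
    (γD : ∀ k, G.DynInfo k → Act n k) (hγD : ∀ k, G.AdmissibleFor k (γD k))
    (hC : G.ConditionC μ ζ γD) (hfin : G.FiniteCostsNear μ ζ γD)
    (γS : ∀ k, G.StatInfo k → Act n k) (hγS : ∀ k, G.AdmissibleFor k (γS k))
    (hred : G.IsStaticReduction μ ζ γD γS) :
    (G.IsStationary μ ζ G.dynPlay G.dynObs γD ↔ G.IsStationary μ ζ G.statPlay G.statObs γS) ∧
    (G.IsDMNash μ ζ G.dynPlay γD ↔ G.IsDMNash μ ζ G.statPlay γS) := by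
  have h : G.ReducedPolicy μ ζ γD γS :=
    ⟨hζ, hinv, hcost, hprop, hγD, hC, hfin, hγS, hred⟩
  rw [h.isStationary_dyn_iff, h.isStationary_stat_iff, h.isDMNash_dyn_iff, h.isDMNash_stat_iff]
  exact ⟨h.forall_dynFirstOrder_iff, h.forall_dynFirstOrder_iff⟩
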